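/- Let $n\ge 1$ be an integer, $\delta=-\frac1{2n+1}$, $c=\frac14(1-\delta^2)$, $v_1=-\frac{2}{1+\delta}$, $v_2=-\frac{2}{1-\delta}$, and $$H(x,y)=\frac{y\,(1-xy/v_1)^n}{(1-xy/v_2)^{n+1}}$$ (a first integral of $y'=c\,x\,y^3+y^2$). Let $y_0\in\mathbb C\setminus\{0\}$, put $x_0=\kappa/y_0$ with $\kappa=-v_2(v_2/v_1)^n$ (the movable singularity of the solution), and let $Y_{y_0}=\{(x,y)\in\mathbb C^2:\ xy\ne v_2,\ H(x,y)=y_0\}$. **Theorem 6.1.** (1) The solution curve $Y_{y_0}$ is irreducible: it is the zero set of the polynomial $y(1-xy/v_1)^n-y_0(1-xy/v_2)^{n+1}$, this polynomial is irreducible in $\mathbb C[x,y]$, and $Y_{y_0}$ is a nonempty algebraic set which is not the union of two proper algebraic subsets. (2) The equation $y'=c\,x\,y^3+y^2$ has a holomorphic solution near $0$ with $y(0)=y_0$, and every such local solution $\varphi$ is a regular local branch of $Y_{y_0}$ at $0$, that is, $(x,\varphi(x))\in Y_{y_0}$ for $x$ near $0$. Let $0<r<1$, and let $p=\varepsilon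 x_0$ with $0<\varepsilon<1$ be any point of the open segment from $0$ to $x_0$ (arbitrarily close to $0$). Let $\omega$ be the path which follows the straight segment from $0$ to $(1-r)x_0$, goes once counterclockwise around the circle of radius $r|x_0|$ centred at $x_0$, and then follows the straight segment from $(1-r)x_0$ to $p$. By a branch of $Y_{y_0}$ at $p$ we mean a germ at $p$ of a holomorphic function $g$ with $(x,g(x))\in Y_{y_0}$ for $x$ near $p$. Then: * $\varphi$ continues analytically along the straight segment from $0$ to $p$, to a branch of $Y_{y_0}$ at $p$, and there are exactly $n$ other ("remaining") branches of $Y_{y_0}$ at $p$; * for every $m\ge 0$, $\varphi$ continues analytically along $\omega$ followed by $m$ counterclockwise turns around $0$ along the circle $|x|=|p|$, and the result is one of the $n$ remaining branches; * each of the $n$ remaining branches is obtained in this way for some $m$ with $0\le m<n$. -/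

import Mathlib

open Topology Filter

namespace AbelModel

/-! ## The equation `y' = c x y³ + y²` and its first integral -/

/-- `δ = -1 / (2n + 1)`. -/
noncomputable def delta (n : ℕ) : ℂ := -1 / (2 * (n : ℂ) + 1)

/-- The coefficient `c`, determined by `1 - 4c = δ²`. -/
noncomputable def c (n : ℕ) : ℂ := 1 / 4 - delta n ^ 2 / 4

noncomputable def v₁ (n : ℕ) : ℂ := -2 / (1 + delta n)

noncomputable def v₂ (n : ℕ) : ℂ := -2 / (1 - delta n)

/-- The rational first integral; its poles are on the hyperbola `x y = v₂`. -/
noncomputable def H (n : ℕ) (x y : ℂ) : ℂ :=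
  y * (1 - x * y / v₁ n) ^ n / (1 - x * y / v₂ n) ^ (n + 1)

/-- The affine curve `H(x, y) = y₀`, with `x = z 0` and `y = z 1`, inside the domain of definition
of `H`. -/
def solutionCurve (n : ℕ) (y₀ : ℂ) : Set (Fin 2 → ℂ) :=
  {z | 1 - z 0 * z 1 / v₂ n ≠ 0 ∧ H n (z 0) (z 1) = y₀}

/-- The polynomial `y (1 - xy/v₁)ⁿ - y₀ (1 - xy/v₂)ⁿ⁺¹`, with `x = X 0` and `y = X 1`. -/
noncomputable def curvePolynomial (n : ℕ) (y₀ : ℂ) : MvPolynomial (Fin 2) ℂ :=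
  MvPolynomial.X 1 *
      (1 - MvPolynomial.C (v₁ n)⁻¹ * (MvPolynomial.X 0 * MvPolynomial.X 1)) ^ n -
    MvPolynomial.C y₀ *
      (1 - MvPolynomial.C (v₂ n)⁻¹ * (MvPolynomial.X 0 * MvPolynomial.X 1)) ^ (n + 1)

/-- The movable singularity `x₀ = κ / y₀`, where `κ = -v₂ (v₂ / v₁)ⁿ`. -/
noncomputable def movableSingularity (n : ℕ) (y₀ : ℂ) : ℂ :=
  -v₂ n * (v₂ n / v₁ n) ^ n / y₀

/-- `φ` represents the germ at `0` of the solution of `y' = c x y³ + y²`, `y(0) = y₀`. -/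
def IsLocalSolution (n : ℕ) (y₀ : ℂ) (φ : ℂ → ℂ) : Prop :=
  AnalyticAt ℂ φ 0 ∧ φ 0 = y₀ ∧
    ∀ᶠ x in 𝓝 (0 : ℂ), HasDerivAt φ (c n * x * φ x ^ 3 + φ x ^ 2) x

/-! ## Irreducibility of affine algebraic sets -/

/-- Closed in the Zariski topology of the affine space. -/
def IsZariskiClosed {σ : Type*} (Z : Set (σ → ℂ)) : Prop :=
  ∃ I : Ideal (MvPolynomial σ ℂ), Z = MvPolynomial.zeroLocus ℂ I

/-- A nonempty algebraic set which is not a union of two proper algebraic subsets. -/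
def IsIrreducibleAlgebraicSet {σ : Type*} (Y : Set (σ → ℂ)) : Prop :=
  IsZariskiClosed Y ∧ Y.Nonempty ∧
    ∀ Z W : Set (σ → ℂ), IsZariskiClosed Z → IsZariskiClosed W →
      Y ⊆ Z ∪ W → Y ⊆ Z ∨ Y ⊆ W

/-! ## Analytic continuation along paths -/

/-- The germ of `f` at `a` has an analytic continuation along `γ`, and the resulting germ at `b` is
the germ of `g`: there are analytic germs `F t` at `γ t`, starting with `f` and ending with `g`,
such that `F s` is obtained by direct continuation of `F t` when `s` is near `t`. -/
def ContinuesTo {a b : ℂ} (γ : Path a b) (f g : ℂ → ℂ) : Prop :=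
  ∃ F : unitInterval → ℂ → ℂ,
    (∀ t, AnalyticAt ℂ (F t) (γ t)) ∧
    (∀ t, ∀ᶠ s in 𝓝 t, F s =ᶠ[𝓝 (γ s)] F t) ∧
    F 0 =ᶠ[𝓝 a] f ∧ F 1 =ᶠ[𝓝 b] g

/-- One counterclockwise turn around `z`, starting and ending at `a`, along the circle with centre
`z`. -/
noncomputable def turn (z a : ℂ) : Path a a where
  toFun t := z + (a - z) * Complex.exp (2 * Real.pi * Complex.I * ((t : ℝ) : ℂ))
  continuous_toFun := by fun_prop
  source' := by simp
  target' := by simp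

/-- `m` successive counterclockwise turns around `z`, starting and ending at `a`. -/
noncomputable def turns (z a : ℂ) : ℕ → Path a a
  | 0 => Path.refl a
  | m + 1 => (turns z a m).trans (turn z a)

/-- The path `ω`: from `0` along the straight segment to the point `q = (1 - r) x₀` at distance
`r |x₀|` from `x₀`, once counterclockwise around `x₀`, and then along the straight segment to `p`. -/
noncomputable def omega (x₀ : ℂ) (r : ℝ) (p : ℂ) : Path (0 : ℂ) p :=
  ((Path.segment 0 ((1 - (r : ℂ)) * x₀)).trans (turn x₀ ((1 - (r : ℂ)) * x₀))).trans
    (Path.segment ((1 - (r : ℂ)) * x₀) p)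

/-- `ω`, followed by `m` turns around `0`. -/
noncomputable def omegaThenTurns (x₀ : ℂ) (r : ℝ) (p : ℂ) (m : ℕ) : Path (0 : ℂ) p :=
  (omega x₀ r p).trans (turns 0 p m)

/-! ## Local branches -/

/-- `g` represents a regular local branch at `p` of the curve `H(x, y) = y₀`. -/
def IsBranch (n : ℕ) (y₀ p : ℂ) (g : ℂ → ℂ) : Prop :=
  AnalyticAt ℂ g p ∧ ∀ᶠ x in 𝓝 p, ![x, g x] ∈ solutionCurve n y₀

/-- `g` represents a local branch at `p` other than the one obtained from the germ `φ` at `0` by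
continuation along the straight segment from `0` to `p`. -/
def IsRemainingBranch (n : ℕ) (y₀ : ℂ) (φ : ℂ → ℂ) (p : ℂ) (g : ℂ → ℂ) : Prop :=
  IsBranch n y₀ p g ∧ ¬ ContinuesTo (Path.segment 0 p) φ g

/-- The remaining branches at `p`, as a set of germs. -/
def remainingBranches (n : ℕ) (y₀ : ℂ) (φ : ℂ → ℂ) (p : ℂ) : Set (Germ (𝓝 p) ℂ) :=
  {G | ∃ g : ℂ → ℂ, IsRemainingBranch n y₀ φ p g ∧ G = (g : Germ (𝓝 p) ℂ)}

end AbelModel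

/-!
With `N = 2n + 1` and `a = (1 - xy/v₁) / (1 - xy/v₂)`, the curve `H(x, y) = y₀` has the rational
parametrisation
`x = N (1 - a) aⁿ / y₀`, `y = y₀ / (aⁿ ((n + 1) a - n))`,
by the points `a` of the plane other than `0` and `n / (n + 1)`. In these terms `x = x₀ P(a)`, where
the polynomial `P = cover n` is `(1 - a) aⁿ` scaled so that its value at the critical point
`n / (n + 1)`, called `node n`, is `1`; its only other critical point (for `n > 1`) is `0`, with
value `0`.

*Irreducibility.* If the curve lies in the union of two algebraic sets, pull their equations back to
the `a`-plane without two points, which is connected: by the identity theorem one of the two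
families of equations vanishes identically (`isIrreducible_solutionCurve`). If the polynomial of the
curve is a product `f g`, then one factor, say `f`, vanishes on the curve. Above a general `x` the
curve has `n + 1` points, so that `f` already has degree `n + 1` in `y`; hence `g` depends on `x`
only, and has no zeros because the product is `-y₀` on `y = 0` (`irreducible_curvePolynomial`).

*The equation.* A function with graph on the curve solves the equation and conversely, since `H` is
a first integral (`IsBranch.hasDerivAt`, `IsLocalSolution.isBranch`).

*Continuation.* Neither critical point of `P` is a parameter of a point of the curve, so a branch at
`p` is determined by its parameter, a root of `P(a) = p / x₀`, and to continue a branch along a path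
`γ` it suffices to lift `γ / x₀` continuously through `P` (`IsLift.continuesTo`); continuation is
unique (`ContinuesTo.unique`).

*The fibres of `P` above the unit disc.* Since `|P| ≥ 1` wherever `|a| ≥ node n` and
`|1 - a| ≥ 1 - node n`, the disc of radius `1 - node n` around `1` is mapped onto a set containing
the unit disc, and so is the disc of radius `node n` around `0` by the `n`-th root `coverRoot n` of
`P`. As the fibres of `P` have at most `n + 1` points, both maps are injective above the unit disc,
with continuous inverses `outer n` and `inner n`, and the fibre above `uⁿ` consists of `outer n (uⁿ)`
and of `inner n (ζᵏ u)` for `ζ = exp (2πi/n)` and `k < n` (`eq_outer_or_eq_inner`). The solution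
`φ` follows `outer`, starting at `outer n 0 = 1`; the `n` remaining branches are given by `inner`,
and a turn around `0` multiplies `u` by `ζ`, hence permutes them cyclically.

*The movable singularity.* Near `node n` the function `1 - P` is the square of a local coordinate,
so a small turn around `1` exchanges the real points `outer n (1 - r)` and `inner n (1 - r)^(1/n)`
(`exists_small_loop`). As `P` is a covering outside the critical values `0` and `1`, lifting a
homotopy of circles gives the same for every radius `r < 1` (`exists_loop`). Thus `ω` carries `φ` to
the remaining branch with real parameter, from which the turns around `0` reach the other ones.
-/

namespace AbelModel

variable {n : ℕ}

/-! ### The rational parametrisation of the curve -/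

/-- The critical point `n / (n + 1)` of `a ↦ (1 - a) aⁿ`. -/
noncomputable def node (n : ℕ) : ℝ := n / (n + 1)

/-- The polynomial map `(1 - a) aⁿ`, scaled so that its critical value at `node n` is `1`. -/
noncomputable def cover (n : ℕ) (a : ℂ) : ℂ :=
  (1 - a) * a ^ n / ((1 - node n) * (node n : ℂ) ^ n)

/-- The ordinate of the point of the curve with parameter `a`. -/
noncomputable def ordinate (n : ℕ) (y₀ a : ℂ) : ℂ := y₀ / (a ^ n * ((n + 1) * a - n))

/-- The parameter `a = (1 - xy/v₁) / (1 - xy/v₂)` of a point of the curve. -/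
noncomputable def parameter (n : ℕ) (x y : ℂ) : ℂ := (1 - x * y / v₁ n) / (1 - x * y / v₂ n)

lemma two_mul_add_one_ne_zero (n : ℕ) : (2 * (n : ℂ) + 1) ≠ 0 := by
  exact_mod_cast (Nat.succ_ne_zero (2 * n))

lemma cast_ne_zero (hn : 1 ≤ n) : (n : ℂ) ≠ 0 := by
  exact_mod_cast (by omega : n ≠ 0)

lemma node_pos (hn : 1 ≤ n) : 0 < node n := by
  have : (0 : ℝ) < n := by exact_mod_cast hn
  unfold node; positivity

lemma node_lt_one (n : ℕ) : node n < 1 := by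
  unfold node
  rw [div_lt_one (by positivity)]
  linarith

lemma node_cast (n : ℕ) : (node n : ℂ) = n / (n + 1) := by
  simp [node]

lemma node_ne_zero (hn : 1 ≤ n) : (node n : ℂ) ≠ 0 := by
  exact_mod_cast (node_pos hn).ne'

lemma one_sub_node_ne_zero (n : ℕ) : 1 - (node n : ℂ) ≠ 0 := by
  have := (sub_pos.2 (node_lt_one n)).ne'
  exact_mod_cast this

lemma scale_ne_zero (hn : 1 ≤ n) : (1 - node n) * (node n : ℂ) ^ n ≠ 0 :=
  mul_ne_zero (one_sub_node_ne_zero n) (pow_ne_zero _ (node_ne_zero hn))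

lemma sub_eq_node (n : ℕ) (a : ℂ) : (n + 1) * a - n = (n + 1) * (a - node n) := by
  have := Nat.cast_add_one_ne_zero (R := ℂ) n
  rw [node_cast]; field_simp

lemma ordinate_denom_ne_zero {a : ℂ} (ha : a ≠ 0) (ha' : a ≠ node n) :
    a ^ n * ((n + 1) * a - n) ≠ 0 := by
  rw [sub_eq_node]
  exact mul_ne_zero (pow_ne_zero _ ha)
    (mul_ne_zero (Nat.cast_add_one_ne_zero n) (sub_ne_zero.2 ha'))

lemma div_v₁ (hn : 1 ≤ n) (z : ℂ) : z / v₁ n = -(n / (2 * n + 1)) * z := by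
  have h1 := two_mul_add_one_ne_zero n
  have h2 := cast_ne_zero hn
  have h3 : (1 : ℂ) + delta n = 2 * n / (2 * n + 1) := by
    unfold delta; field_simp; ring
  rw [v₁, h3]; field_simp

lemma div_v₂ (n : ℕ) (z : ℂ) : z / v₂ n = -((n + 1) / (2 * n + 1)) * z := by
  have h1 := two_mul_add_one_ne_zero n
  have h2 := Nat.cast_add_one_ne_zero (R := ℂ) n
  have h3 : (1 : ℂ) - delta n = 2 * (n + 1) / (2 * n + 1) := by
    unfold delta; field_simp; ring
  rw [v₂, h3]; field_simp

lemma c_eq (n : ℕ) : c n = n * (n + 1) / (2 * n + 1) ^ 2 := by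
  have h1 := two_mul_add_one_ne_zero n
  unfold c delta; field_simp; ring

lemma movableSingularity_eq (hn : 1 ≤ n) (y₀ : ℂ) :
    movableSingularity n y₀ = (2 * n + 1) * ((1 - node n) * (node n : ℂ) ^ n) / y₀ := by
  have h1 := two_mul_add_one_ne_zero n
  have h2 := cast_ne_zero hn
  have h3 := Nat.cast_add_one_ne_zero (R := ℂ) n
  have e2 : (v₂ n)⁻¹ = -((n + 1) / (2 * n + 1)) := by
    simpa using div_v₂ n 1
  have e2' : v₂ n = -((2 * n + 1) / (n + 1)) := by
    rw [← inv_inv (v₂ n), e2, inv_neg, inv_div]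
  have e3 : v₂ n / v₁ n = node n := by
    rw [div_v₁ hn, e2', node_cast]
    generalize 2 * (n : ℂ) + 1 = N at *
    field_simp
  have e4 : 1 - (n : ℂ) / (n + 1) = 1 / (n + 1) := by field_simp; ring
  rw [movableSingularity, e3, e2', node_cast, e4]
  ring

lemma movableSingularity_ne_zero (hn : 1 ≤ n) {y₀ : ℂ} (hy₀ : y₀ ≠ 0) :
    movableSingularity n y₀ ≠ 0 := by
  rw [movableSingularity_eq hn]
  exact div_ne_zero (mul_ne_zero (two_mul_add_one_ne_zero n) (scale_ne_zero hn)) hy₀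

/-- The abscissa of the point with parameter `a` is `(2n + 1) (1 - a) aⁿ / y₀`. -/
lemma abscissa_eq (hn : 1 ≤ n) (y₀ a : ℂ) :
    movableSingularity n y₀ * cover n a = (2 * n + 1) * ((1 - a) * a ^ n) / y₀ := by
  have := scale_ne_zero hn
  rw [movableSingularity_eq hn, cover]
  generalize (1 - (node n : ℂ)) * (node n : ℂ) ^ n = M at *
  field_simp

lemma abscissa_mul_ordinate (hn : 1 ≤ n) {y₀ : ℂ} (hy₀ : y₀ ≠ 0) {a : ℂ} (ha : a ≠ 0) :
    movableSingularity n y₀ * cover n a * ordinate n y₀ a =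
      (2 * n + 1) * (1 - a) / ((n + 1) * a - n) := by
  rw [abscissa_eq hn, ordinate]
  have := pow_ne_zero n ha
  field_simp

lemma one_sub_div_v₂ (hn : 1 ≤ n) {y₀ : ℂ} (hy₀ : y₀ ≠ 0) {a : ℂ} (ha : a ≠ 0)
    (ha' : a ≠ node n) :
    1 - movableSingularity n y₀ * cover n a * ordinate n y₀ a / v₂ n = 1 / ((n + 1) * a - n) := by
  have h1 := two_mul_add_one_ne_zero n
  have h2 := right_ne_zero_of_mul (ordinate_denom_ne_zero (n := n) ha ha')
  rw [abscissa_mul_ordinate hn hy₀ ha, div_v₂]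
  generalize 2 * (n : ℂ) + 1 = N at *
  obtain ⟨d, hd⟩ : ∃ d, (n + 1) * a - n = d := ⟨_, rfl⟩
  rw [hd] at h2 ⊢
  field_simp
  rw [← hd]
  ring

lemma one_sub_div_v₁ (hn : 1 ≤ n) {y₀ : ℂ} (hy₀ : y₀ ≠ 0) {a : ℂ} (ha : a ≠ 0)
    (ha' : a ≠ node n) :
    1 - movableSingularity n y₀ * cover n a * ordinate n y₀ a / v₁ n = a / ((n + 1) * a - n) := by
  have h1 := two_mul_add_one_ne_zero n
  have h2 := right_ne_zero_of_mul (ordinate_denom_ne_zero (n := n) ha ha')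
  rw [abscissa_mul_ordinate hn hy₀ ha, div_v₁ hn]
  generalize 2 * (n : ℂ) + 1 = N at *
  obtain ⟨d, hd⟩ : ∃ d, (n + 1) * a - n = d := ⟨_, rfl⟩
  rw [hd] at h2 ⊢
  field_simp
  rw [← hd]
  ring

lemma parameter_param (hn : 1 ≤ n) {y₀ : ℂ} (hy₀ : y₀ ≠ 0) {a : ℂ} (ha : a ≠ 0)
    (ha' : a ≠ node n) :
    parameter n (movableSingularity n y₀ * cover n a) (ordinate n y₀ a) = a := by
  have h2 := right_ne_zero_of_mul (ordinate_denom_ne_zero (n := n) ha ha')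
  rw [parameter, one_sub_div_v₂ hn hy₀ ha ha', one_sub_div_v₁ hn hy₀ ha ha']
  generalize (n + 1) * a - n = d at *
  field_simp

lemma param_mem_solutionCurve (hn : 1 ≤ n) {y₀ : ℂ} (hy₀ : y₀ ≠ 0) {a : ℂ} (ha : a ≠ 0)
    (ha' : a ≠ node n) :
    ![movableSingularity n y₀ * cover n a, ordinate n y₀ a] ∈ solutionCurve n y₀ := by
  have h2 := right_ne_zero_of_mul (ordinate_denom_ne_zero (n := n) ha ha')
  have h3 := pow_ne_zero n ha
  simp only [solutionCurve, H, Set.mem_ofPred_eq, Matrix.cons_val_zero, Matrix.cons_val_one]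
  rw [one_sub_div_v₂ hn hy₀ ha ha', one_sub_div_v₁ hn hy₀ ha ha']
  refine ⟨one_div_ne_zero h2, ?_⟩
  rw [ordinate]
  generalize (n + 1) * a - n = d at *
  rw [div_pow, div_pow, one_pow, pow_succ]
  field_simp

lemma mem_solutionCurve {y₀ x y : ℂ} :
    ![x, y] ∈ solutionCurve n y₀ ↔ 1 - x * y / v₂ n ≠ 0 ∧
      y * (1 - x * y / v₁ n) ^ n = y₀ * (1 - x * y / v₂ n) ^ (n + 1) := by
  simp only [solutionCurve, H, Set.mem_ofPred_eq, Matrix.cons_val_zero, Matrix.cons_val_one]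
  refine and_congr_right fun h => ?_
  rw [div_eq_iff (pow_ne_zero _ h)]

/-- `n + 1` times the parameter minus `n` is `1 / (1 - xy/v₂)`. -/
lemma parameter_sub (hn : 1 ≤ n) {x y : ℂ} (h : 1 - x * y / v₂ n ≠ 0) :
    (n + 1) * parameter n x y - n = 1 / (1 - x * y / v₂ n) := by
  have h1 := two_mul_add_one_ne_zero n
  rw [parameter]
  field_simp
  rw [div_v₂, div_v₁ hn]
  field_simp
  ring

lemma parameter_ne_zero (hn : 1 ≤ n) {y₀ x y : ℂ} (hy₀ : y₀ ≠ 0)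
    (h : ![x, y] ∈ solutionCurve n y₀) : parameter n x y ≠ 0 := by
  rw [mem_solutionCurve] at h
  refine div_ne_zero (fun h0 => ?_) h.1
  have := h.2
  rw [h0, zero_pow (by omega), mul_zero] at this
  exact mul_ne_zero hy₀ (pow_ne_zero _ h.1) this.symm

lemma parameter_ne_node (hn : 1 ≤ n) {y₀ x y : ℂ}
    (h : ![x, y] ∈ solutionCurve n y₀) : parameter n x y ≠ node n := by
  intro h0
  have h1 := parameter_sub hn (mem_solutionCurve.1 h).1
  rw [sub_eq_node, h0, sub_self, mul_zero] at h1
  exact one_div_ne_zero (mem_solutionCurve.1 h).1 h1.symm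

lemma ordinate_parameter (hn : 1 ≤ n) {y₀ x y : ℂ} (hy₀ : y₀ ≠ 0)
    (h : ![x, y] ∈ solutionCurve n y₀) : ordinate n y₀ (parameter n x y) = y := by
  have h0 := parameter_ne_zero hn hy₀ h
  obtain ⟨h1, h2⟩ := mem_solutionCurve.1 h
  rw [ordinate, div_eq_iff (ordinate_denom_ne_zero h0 (parameter_ne_node hn h)),
    parameter_sub hn h1, parameter, div_pow]
  rw [pow_succ] at h2
  generalize 1 - x * y / v₂ n = q at *
  generalize (1 - x * y / v₁ n) ^ n = w at *
  field_simp
  linear_combination -h2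

lemma cover_parameter (hn : 1 ≤ n) {y₀ x y : ℂ} (hy₀ : y₀ ≠ 0)
    (h : ![x, y] ∈ solutionCurve n y₀) :
    cover n (parameter n x y) = x / movableSingularity n y₀ := by
  have hx₀ := movableSingularity_ne_zero hn hy₀
  obtain ⟨h1, h2⟩ := mem_solutionCurve.1 h
  have hN := two_mul_add_one_ne_zero n
  rw [eq_div_iff hx₀, mul_comm, abscissa_eq hn, div_eq_iff hy₀]
  have h3 : 1 - parameter n x y = x * y / (2 * n + 1) / (1 - x * y / v₂ n) := by
    rw [parameter]
    field_simp
    rw [div_v₂, div_v₁ hn]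
    linear_combination x * y * mul_inv_cancel₀ hN
  have h4 : x * (y * (1 - x * y / v₁ n) ^ n) = x * (y₀ * (1 - x * y / v₂ n) ^ (n + 1)) := by
    rw [h2]
  rw [h3, parameter, div_pow]
  generalize 1 - x * y / v₂ n = q at *
  generalize (1 - x * y / v₁ n) ^ n = w at *
  generalize 2 * (n : ℂ) + 1 = N at *
  field_simp
  linear_combination h4

lemma cover_zero (hn : 1 ≤ n) : cover n 0 = 0 := by
  simp [cover, zero_pow (by omega : n ≠ 0)]

lemma cover_one (n : ℕ) : cover n 1 = 0 := by simp [cover]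

lemma cover_node (hn : 1 ≤ n) : cover n (node n) = 1 := by
  rw [cover]; exact div_self (scale_ne_zero hn)

lemma hasDerivAt_cover (hn : 1 ≤ n) (a : ℂ) :
    HasDerivAt (cover n)
      ((n + 1) * a ^ (n - 1) * (node n - a) / ((1 - node n) * (node n : ℂ) ^ n)) a := by
  have h := ((((hasDerivAt_id a).const_sub 1).mul (hasDerivAt_pow n a))).div_const
    ((1 - node n) * (node n : ℂ) ^ n)
  refine h.congr_deriv ?_
  congr 1
  obtain ⟨k, rfl⟩ : ∃ k, n = k + 1 := ⟨n - 1, by omega⟩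
  have h3 := Nat.cast_add_one_ne_zero (R := ℂ) (k + 1)
  rw [node_cast]
  simp only [id, Nat.add_sub_cancel]
  field_simp
  push_cast
  ring

lemma deriv_cover_ne_zero (hn : 1 ≤ n) {a : ℂ} (ha : a ≠ 0) (ha' : a ≠ node n) :
    (n + 1) * a ^ (n - 1) * (node n - a) / ((1 - node n) * (node n : ℂ) ^ n) ≠ 0 :=
  div_ne_zero (mul_ne_zero (mul_ne_zero (Nat.cast_add_one_ne_zero n) (pow_ne_zero _ ha))
    (sub_ne_zero.2 ha'.symm)) (scale_ne_zero hn)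

lemma analyticAt_cover (n : ℕ) (a : ℂ) : AnalyticAt ℂ (cover n) a := by
  unfold cover
  fun_prop (disch := simp)

/-! ### Analytic continuation along paths -/

/-- Analytic continuation of a germ along a path is unique. -/
lemma ContinuesTo.unique {p q : ℂ} {γ : Path p q} {f g₁ g₂ : ℂ → ℂ}
    (h₁ : ContinuesTo γ f g₁) (h₂ : ContinuesTo γ f g₂) : g₁ =ᶠ[𝓝 q] g₂ := by
  obtain ⟨F, hF, hFc, hF0, hF1⟩ := h₁
  obtain ⟨G, hG, hGc, hG0, hG1⟩ := h₂
  -- The times at which the two families of germs agree form a clopen set.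
  let S : Set unitInterval := {t | F t =ᶠ[𝓝 (γ t)] G t}
  have hopen : IsOpen S := by
    rw [isOpen_iff_mem_nhds]
    intro t ht
    have hc := γ.continuous.continuousAt (x := t)
    filter_upwards [hFc t, hGc t, hc.eventually (eventually_eventually_nhds.2 ht)]
      with s h1 h2 h3
    exact h1.trans (EventuallyEq.trans h3 h2.symm)
  have hclosed : IsClosed S := by
    rw [isClosed_iff_frequently]
    intro t ht
    obtain ⟨ρ, hρ, hball⟩ := Metric.eventually_nhds_iff_ball.1
      ((hF t).eventually_analyticAt.and (hG t).eventually_analyticAt)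
    have hc := γ.continuous.continuousAt (x := t)
    obtain ⟨s, hs, h1, h2, h3⟩ := (ht.and_eventually ((hFc t).and ((hGc t).and
      (hc.eventually (Metric.ball_mem_nhds _ hρ))))).exists
    have h4 : F t =ᶠ[𝓝 (γ s)] G t := h1.symm.trans (EventuallyEq.trans hs h2)
    have h5 := AnalyticOnNhd.eqOn_of_preconnected_of_eventuallyEq
      (fun z hz => (hball z hz).1) (fun z hz => (hball z hz).2)
      (convex_ball (γ t) ρ).isPreconnected h3 h4
    exact h5.eventuallyEq_of_mem (Metric.ball_mem_nhds _ hρ)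
  have huniv : S = Set.univ := IsClopen.eq_univ ⟨hclosed, hopen⟩
    ⟨0, by simpa [S] using hF0.trans hG0.symm⟩
  have h1 : (1 : unitInterval) ∈ S := huniv ▸ Set.mem_univ _
  have h1' : F 1 =ᶠ[𝓝 q] G 1 := by simpa [S] using h1
  exact hF1.symm.trans (h1'.trans hG1)

variable {y₀ : ℂ}

lemma exists_local_inverse (hn : 1 ≤ n) {a : ℂ} (ha : a ≠ 0) (ha' : a ≠ node n) :
    ∃ L : ℂ → ℂ, AnalyticAt ℂ L (cover n a) ∧ L (cover n a) = a ∧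
      (∀ᶠ b in 𝓝 a, L (cover n b) = b) ∧ ∀ᶠ z in 𝓝 (cover n a), cover n (L z) = z := by
  have hd := hasDerivAt_cover hn a
  have hne : deriv (cover n) a ≠ 0 := by
    rw [hd.deriv]; exact deriv_cover_ne_zero hn ha ha'
  have han := analyticAt_cover n a
  refine ⟨_, han.analyticAt_localInverse hne, ?_, ?_, ?_⟩
  · exact HasStrictFDerivAt.localInverse_apply_image ..
  · exact HasStrictDerivAt.eventually_left_inverse ..
  · exact HasStrictDerivAt.eventually_right_inverse ..

/-- A local inverse of `cover n` at `a`, when `a` is not a critical point; the zero function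
otherwise. -/
noncomputable def localInv (n : ℕ) (a : ℂ) : ℂ → ℂ :=
  open Classical in
  if h : 1 ≤ n ∧ a ≠ 0 ∧ a ≠ node n then (exists_local_inverse h.1 h.2.1 h.2.2).choose else 0

lemma localInv_spec (hn : 1 ≤ n) {a : ℂ} (ha : a ≠ 0) (ha' : a ≠ node n) :
    AnalyticAt ℂ (localInv n a) (cover n a) ∧ localInv n a (cover n a) = a ∧
      (∀ᶠ b in 𝓝 a, localInv n a (cover n b) = b) ∧
      ∀ᶠ z in 𝓝 (cover n a), cover n (localInv n a z) = z := by
  rw [localInv, dif_pos ⟨hn, ha, ha'⟩]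
  exact (exists_local_inverse hn ha ha').choose_spec

/-- The branch of the curve through the point with parameter `a`. -/
noncomputable def branchAt (n : ℕ) (y₀ a : ℂ) (x : ℂ) : ℂ :=
  ordinate n y₀ (localInv n a (x / movableSingularity n y₀))

lemma analyticAt_ordinate {a : ℂ} (ha : a ≠ 0) (ha' : a ≠ node n) :
    AnalyticAt ℂ (ordinate n y₀) a := by
  have := ordinate_denom_ne_zero (n := n) ha ha'
  unfold ordinate
  fun_prop (disch := assumption)

lemma isBranch_branchAt (hn : 1 ≤ n) (hy₀ : y₀ ≠ 0) {a p : ℂ} (ha : a ≠ 0) (ha' : a ≠ node n)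
    (hp : cover n a = p / movableSingularity n y₀) :
    IsBranch n y₀ p (branchAt n y₀ a) ∧ parameter n p (branchAt n y₀ a p) = a := by
  have hx₀ := movableSingularity_ne_zero hn hy₀
  obtain ⟨h1, h2, h3, h4⟩ := localInv_spec hn ha ha'
  have hdiv : AnalyticAt ℂ (fun x => x / movableSingularity n y₀) p := by
    fun_prop (disch := assumption)
  have hL : AnalyticAt ℂ (fun x => localInv n a (x / movableSingularity n y₀)) p := by
    rw [hp] at h1
    exact AnalyticAt.fun_comp (g := localInv n a) h1 hdiv
  have hLp : localInv n a (p / movableSingularity n y₀) = a := by rw [← hp, h2]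
  refine ⟨⟨?_, ?_⟩, ?_⟩
  · refine AnalyticAt.fun_comp (g := ordinate n y₀) ?_ hL
    rw [hLp]; exact analyticAt_ordinate ha ha'
  · have hc := hL.continuousAt
    rw [ContinuousAt, hLp] at hc
    rw [hp] at h4
    filter_upwards [hdiv.continuousAt.eventually h4, hc.eventually_ne ha, hc.eventually_ne ha']
      with x hx1 hx2 hx3
    have := param_mem_solutionCurve hn hy₀ hx2 hx3
    rw [hx1, mul_div_cancel₀ _ hx₀] at this
    exact this
  · have := parameter_param hn hy₀ ha ha'
    rw [hp, mul_div_cancel₀ _ hx₀] at this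
    rw [branchAt, hLp, this]

/-- A branch of the curve is determined by the parameter of its centre. -/
lemma IsBranch.eventuallyEq_branchAt (hn : 1 ≤ n) (hy₀ : y₀ ≠ 0) {p a : ℂ} {g : ℂ → ℂ}
    (hg : IsBranch n y₀ p g) (ha : parameter n p (g p) = a) :
    g =ᶠ[𝓝 p] branchAt n y₀ a := by
  have hmem := hg.2.self_of_nhds
  have h0 := parameter_ne_zero hn hy₀ hmem
  have h0' := parameter_ne_node hn hmem
  have hc : ContinuousAt (fun x => parameter n x (g x)) p := by
    have := hg.1.continuousAt
    have h1 := (mem_solutionCurve.1 hmem).1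
    unfold parameter
    fun_prop (disch := assumption)
  subst ha
  filter_upwards [hg.2, hc.eventually (localInv_spec hn h0 h0').2.2.1] with x hx1 hx2
  rw [cover_parameter hn hy₀ hx1] at hx2
  rw [branchAt, hx2, ordinate_parameter hn hy₀ hx1]

/-- `ℓ` is a path of parameters, from `a` to `b`, of points of the curve above the path `γ`. -/
def IsLift (n : ℕ) (y₀ : ℂ) {p q a b : ℂ} (γ : Path p q) (ℓ : Path a b) : Prop :=
  ∀ t, cover n (ℓ t) = γ t / movableSingularity n y₀ ∧ ℓ t ≠ 0 ∧ ℓ t ≠ node n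

lemma IsLift.trans {p q s a b d : ℂ} {γ : Path p q} {γ' : Path q s} {ℓ : Path a b} {ℓ' : Path b d}
    (h : IsLift n y₀ γ ℓ) (h' : IsLift n y₀ γ' ℓ') : IsLift n y₀ (γ.trans γ') (ℓ.trans ℓ') := by
  intro t
  rw [Path.trans_apply, Path.trans_apply]
  split_ifs
  · exact h _
  · exact h' _

/-- Lifting a path to the curve continues the branches of the curve along the path. -/
lemma IsLift.continuesTo (hn : 1 ≤ n) (hy₀ : y₀ ≠ 0) {p q a b : ℂ} {γ : Path p q} {ℓ : Path a b}
    (h : IsLift n y₀ γ ℓ) {f g : ℂ → ℂ} (hf : IsBranch n y₀ p f) (hfa : parameter n p (f p) = a)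
    (hg : IsBranch n y₀ q g) (hgb : parameter n q (g q) = b) : ContinuesTo γ f g := by
  refine ⟨fun t => branchAt n y₀ (ℓ t), fun t => ?_, fun t => ?_, ?_, ?_⟩
  · exact (isBranch_branchAt hn hy₀ (h t).2.1 (h t).2.2 (h t).1).1.1
  · have h1 := (localInv_spec hn (h t).2.1 (h t).2.2).2.2.1
    filter_upwards [ℓ.continuous.continuousAt.eventually (eventually_eventually_nhds.2 h1)]
      with s hs
    obtain ⟨h2, h3, -, h4⟩ := localInv_spec hn (h s).2.1 (h s).2.2
    have hdiv : ContinuousAt (fun x => x / movableSingularity n y₀) (γ s) := by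
      fun_prop (disch := exact movableSingularity_ne_zero hn hy₀)
    have hc := h2.continuousAt
    rw [ContinuousAt, h3, (h s).1] at hc
    rw [(h s).1] at h4
    filter_upwards [hdiv.eventually h4, (hc.comp hdiv).eventually hs] with x hx1 hx2
    simp only [Function.comp] at hx2
    rw [hx1] at hx2
    rw [branchAt, branchAt, hx2]
  · simp only [Path.source]
    exact (hf.eventuallyEq_branchAt hn hy₀ hfa).symm
  · simp only [Path.target]
    exact (hg.eventuallyEq_branchAt hn hy₀ hgb).symm

/-! ### The parameters above a disc around the origin -/

/-- A holomorphic function with `‖f‖ ≥ 1` on the boundary of a disc which vanishes at the centre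
maps the disc onto a set containing the unit disc. -/
lemma ball_subset_image_ball {f : ℂ → ℂ} {z₀ : ℂ} {R : ℝ} (hR : 0 < R)
    (hf : AnalyticOnNhd ℂ f (Metric.closedBall z₀ R)) (h0 : f z₀ = 0)
    (hs : ∀ z ∈ Metric.sphere z₀ R, 1 ≤ ‖f z‖) :
    Metric.ball 0 1 ⊆ f '' Metric.ball z₀ R ∧
      ∀ s ⊆ Metric.ball z₀ R, IsOpen s → IsOpen (f '' s) := by
  have hopen : ∀ s ⊆ Metric.ball z₀ R, IsOpen s → IsOpen (f '' s) := by
    refine ((hf.mono Metric.ball_subset_closedBall).is_constant_or_isOpen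
      (convex_ball z₀ R).isPreconnected).resolve_left ?_
    rintro ⟨w, hw⟩
    have hw0 : w = 0 := by rw [← hw z₀ (Metric.mem_ball_self hR), h0]
    subst hw0
    have he : f =ᶠ[𝓝 z₀] fun _ => 0 := by
      filter_upwards [Metric.ball_mem_nhds z₀ hR] with z hz using hw z hz
    have heq := hf.eqOn_of_preconnected_of_eventuallyEq analyticOnNhd_const
      (convex_closedBall z₀ R).isPreconnected (Metric.mem_closedBall_self hR.le) he
    obtain ⟨z, hz⟩ := NormedSpace.sphere_nonempty (x := z₀) |>.2 hR.le
    have := hs z hz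
    rw [heq (Metric.sphere_subset_closedBall hz), norm_zero] at this
    norm_num at this
  refine ⟨(convex_ball (0 : ℂ) 1).isPreconnected.subset_of_closure_inter_subset
    (hopen _ subset_rfl Metric.isOpen_ball)
    ⟨0, Metric.mem_ball_self one_pos, z₀, Metric.mem_ball_self hR, h0⟩ ?_, hopen⟩
  -- A point of the unit disc in the closure of the image comes from the closed disc, but not from its
  -- boundary circle.
  rintro w ⟨hw, hw1⟩
  have hK : IsClosed (f '' Metric.closedBall z₀ R) :=
    ((isCompact_closedBall z₀ R).image_of_continuousOn hf.continuousOn).isClosed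
  obtain ⟨z, hz, rfl⟩ := closure_minimal (Set.image_mono Metric.ball_subset_closedBall) hK hw
  refine ⟨z, ?_, rfl⟩
  rw [← Metric.sphere_union_ball] at hz
  refine hz.resolve_left fun h => ?_
  rw [mem_ball_zero_iff] at hw1
  exact absurd (hs z h) (not_le.2 hw1)

/-- In the situation of `ball_subset_image_ball`, if every point of the unit disc has a single
preimage, the inverse is continuous. -/
lemma continuousOn_invFunOn {f : ℂ → ℂ} {z₀ : ℂ} {R : ℝ} (hR : 0 < R)
    (hf : AnalyticOnNhd ℂ f (Metric.closedBall z₀ R)) (h0 : f z₀ = 0)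
    (hs : ∀ z ∈ Metric.sphere z₀ R, 1 ≤ ‖f z‖)
    (hinj : ∀ a ∈ Metric.ball z₀ R, ∀ b ∈ Metric.ball z₀ R, ‖f a‖ < 1 → f a = f b → a = b) :
    ContinuousOn (Function.invFunOn f (Metric.ball z₀ R)) (Metric.ball 0 1) := by
  obtain ⟨hsurj, hopen⟩ := ball_subset_image_ball hR hf h0 hs
  set V := Function.invFunOn f (Metric.ball z₀ R)
  intro u hu
  have hVu := Function.invFunOn_mem (hsurj hu)
  refine ContinuousAt.continuousWithinAt (continuousAt_def.2 fun W hW => ?_)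
  obtain ⟨W', hW', hW'o, huW'⟩ := mem_nhds_iff.1 hW
  have h1 : f '' (W' ∩ Metric.ball z₀ R) ∈ 𝓝 u :=
    (hopen _ Set.inter_subset_right (hW'o.inter Metric.isOpen_ball)).mem_nhds
      ⟨V u, ⟨huW', hVu⟩, Function.invFunOn_eq (hsurj hu)⟩
  filter_upwards [h1, Metric.isOpen_ball.mem_nhds hu] with w hw hw1
  obtain ⟨b, ⟨hb1, hb2⟩, rfl⟩ := hw
  have h2 : b = V (f b) := hinj b hb2 _ (Function.invFunOn_mem (hsurj hw1))
    (mem_ball_zero_iff.1 hw1) (Function.invFunOn_eq (hsurj hw1)).symm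
  exact hW' (show V (f b) ∈ W' from h2 ▸ hb1)

/-- An `n`-th root of `cover n`. It is holomorphic on the unit disc, where `1 - a` has positive real
part and the principal branch of the root can be used. -/
noncomputable def coverRoot (n : ℕ) (a : ℂ) : ℂ :=
  a * ((1 - a) / ((1 - node n) * (node n : ℂ) ^ n)) ^ ((n : ℂ)⁻¹)

/-- The solution `a` of `cover n a = z` in the disc around `1` whose boundary contains `node n`. It
is meaningful for `‖z‖ < 1`. -/
noncomputable def outer (n : ℕ) : ℂ → ℂ :=
  Function.invFunOn (cover n) (Metric.ball 1 (1 - node n))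

/-- The solution `a` of `coverRoot n a = u` in the disc of radius `node n` around the origin. It is
meaningful for `‖u‖ < 1`, and `cover n (inner n u) = uⁿ`. -/
noncomputable def inner (n : ℕ) : ℂ → ℂ :=
  Function.invFunOn (coverRoot n) (Metric.ball 0 (node n))

lemma coverRoot_pow (hn : 1 ≤ n) (a : ℂ) : coverRoot n a ^ n = cover n a := by
  rw [coverRoot, mul_pow, Complex.cpow_nat_inv_pow _ (by omega), cover]
  ring

lemma scale_eq_ofReal (n : ℕ) :
    (1 - node n) * (node n : ℂ) ^ n = (((1 - node n) * node n ^ n : ℝ) : ℂ) := by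
  push_cast; rfl

lemma scale_pos (hn : 1 ≤ n) : 0 < (1 - node n) * node n ^ n :=
  mul_pos (sub_pos.2 (node_lt_one n)) (pow_pos (node_pos hn) _)

lemma analyticAt_coverRoot (hn : 1 ≤ n) {a : ℂ} (ha : ‖a‖ < 1) :
    AnalyticAt ℂ (coverRoot n) a := by
  have h : (1 - a) / ((1 - node n) * (node n : ℂ) ^ n) ∈ Complex.slitPlane := by
    left
    rw [scale_eq_ofReal, Complex.div_ofReal_re]
    refine div_pos ?_ (scale_pos hn)
    have := (Complex.re_le_norm a).trans_lt ha
    simpa using this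
  refine analyticAt_id.mul (AnalyticAt.cpow ?_ analyticAt_const h)
  exact (analyticAt_const.sub analyticAt_id).div_const

lemma one_le_norm_cover (hn : 1 ≤ n) {a : ℂ} (h0 : node n ≤ ‖a‖) (h1 : 1 - node n ≤ ‖1 - a‖) :
    1 ≤ ‖cover n a‖ := by
  rw [cover, scale_eq_ofReal, norm_div, Complex.norm_of_nonneg (scale_pos hn).le,
    one_le_div (scale_pos hn), norm_mul, norm_pow]
  have := (node_pos hn).le
  gcongr

lemma one_le_norm_coverRoot (hn : 1 ≤ n) {a : ℂ} (ha : a ∈ Metric.sphere (0 : ℂ) (node n)) :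
    1 ≤ ‖coverRoot n a‖ := by
  rw [mem_sphere_zero_iff_norm] at ha
  by_contra! h
  have h1 : ‖coverRoot n a‖ ^ n < 1 := pow_lt_one₀ (norm_nonneg _) h (by omega)
  rw [← norm_pow, coverRoot_pow hn] at h1
  refine absurd (one_le_norm_cover hn ha.ge ?_) (not_le.2 h1)
  have := norm_sub_norm_le (1 : ℂ) a
  rw [ha, norm_one] at this
  exact this

lemma one_le_norm_cover_of_sphere (hn : 1 ≤ n) {a : ℂ}
    (ha : a ∈ Metric.sphere (1 : ℂ) (1 - node n)) : 1 ≤ ‖cover n a‖ := by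
  rw [mem_sphere_iff_norm, norm_sub_rev] at ha
  refine one_le_norm_cover hn ?_ ha.ge
  have := norm_sub_norm_le (1 : ℂ) (1 - a)
  rw [ha, norm_one, sub_sub_cancel, sub_sub_cancel] at this
  exact this

lemma coverRoot_surj (hn : 1 ≤ n) :
    Metric.ball 0 1 ⊆ coverRoot n '' Metric.ball 0 (node n) :=
  (ball_subset_image_ball (node_pos hn) (fun a ha => analyticAt_coverRoot hn
    ((mem_closedBall_zero_iff.1 ha).trans_lt (node_lt_one n))) (by simp [coverRoot])
    (fun _ => one_le_norm_coverRoot hn)).1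

lemma cover_surj (hn : 1 ≤ n) : Metric.ball 0 1 ⊆ cover n '' Metric.ball 1 (1 - node n) :=
  (ball_subset_image_ball (sub_pos.2 (node_lt_one n)) (fun a _ => analyticAt_cover n a)
    (cover_one n) (fun _ => one_le_norm_cover_of_sphere hn)).1

/-- A fibre of `cover n` has at most `n + 1` elements. -/
lemma card_le_of_cover_eq (hn : 1 ≤ n) {z : ℂ} (hz : z ≠ 0) (s : Finset ℂ)
    (hs : ∀ a ∈ s, cover n a = z) : s.card ≤ n + 1 := by
  open Polynomial in
  let q : ℂ[X] := (1 - X) * X ^ n - C (z * ((1 - node n) * (node n : ℂ) ^ n))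
  have heval : ∀ a, q.eval a = (1 - a) * a ^ n - z * ((1 - node n) * (node n : ℂ) ^ n) := by
    intro a; simp [q]
  have hq : q ≠ 0 := by
    intro h
    have := heval 1
    rw [h] at this
    simp only [Polynomial.eval_zero, sub_self, zero_mul, zero_sub] at this
    exact mul_ne_zero hz (scale_ne_zero hn) (neg_eq_zero.1 this.symm)
  have hdeg : q.natDegree ≤ n + 1 := by
    simp only [q]
    compute_degree
    omega
  refine (Polynomial.card_le_degree_of_subset_roots fun a ha => ?_).trans hdeg
  rw [Polynomial.mem_roots hq, Polynomial.IsRoot, heval, sub_eq_zero]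
  exact (div_eq_iff (scale_ne_zero hn)).1 (hs a ha)

/-- The two discs on which `cover n` is inverted are disjoint, as their radii add up to `1`. -/
lemma disjoint_balls {a : ℂ} (h0 : a ∈ Metric.ball (0 : ℂ) (node n))
    (h1 : a ∈ Metric.ball (1 : ℂ) (1 - node n)) : False := by
  rw [mem_ball_zero_iff] at h0
  rw [mem_ball_iff_norm, norm_sub_rev] at h1
  have := norm_add_le a (1 - a)
  rw [add_sub_cancel, norm_one] at this
  linarith

/-- The fibre of `cover n` above `uⁿ`, where `0 < ‖u‖ < 1`: there are `n` points in the disc of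
radius `node n` around `0`, one for each `n`-th root of `uⁿ`, and one point in the other disc, hence
no further point. -/
lemma fibre_eq (hn : 1 ≤ n) {u : ℂ} (hu : u ≠ 0) {b : ℕ → ℂ} {a₁ : ℂ}
    (hb : ∀ k, b k ∈ Metric.ball (0 : ℂ) (node n))
    (hb' : ∀ k, coverRoot n (b k) = u * Complex.exp (2 * Real.pi * Complex.I / n) ^ k)
    (ha₁ : a₁ ∈ Metric.ball (1 : ℂ) (1 - node n)) (ha₁' : cover n a₁ = u ^ n) {a : ℂ}
    (ha : cover n a = u ^ n) : a = a₁ ∨ ∃ k < n, a = b k := by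
  have hζ := Complex.isPrimitiveRoot_exp n (by omega)
  set ζ := Complex.exp (2 * Real.pi * Complex.I / n)
  have hbinj : Set.InjOn b (Finset.range n) := by
    intro i hi j hj hij
    refine hζ.pow_inj (by simpa using hi) (by simpa using hj) (mul_left_cancel₀ hu ?_)
    rw [← hb', ← hb', hij]
  have hbcov : ∀ k, cover n (b k) = u ^ n := by
    intro k
    rw [← coverRoot_pow hn, hb', mul_pow, ← pow_mul, mul_comm k n, pow_mul, hζ.pow_eq_one, one_pow,
      mul_one]
  by_contra! hne
  have hcard := card_le_of_cover_eq hn (pow_ne_zero n hu)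
    (insert a (insert a₁ ((Finset.range n).image b))) (by
      simp only [Finset.mem_insert, Finset.mem_image]
      rintro c (rfl | rfl | ⟨k, -, rfl⟩)
      exacts [ha, ha₁', hbcov k])
  rw [Finset.card_insert_of_notMem, Finset.card_insert_of_notMem,
    Finset.card_image_of_injOn hbinj, Finset.card_range] at hcard
  · omega
  · simp only [Finset.mem_image, not_exists, not_and]
    rintro k - rfl
    exact disjoint_balls (hb k) ha₁
  · simp only [Finset.mem_insert, Finset.mem_image, not_or, not_exists, not_and]
    refine ⟨hne.1, fun k hk h => hne.2 k (by simpa using hk) h.symm⟩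

lemma norm_mul_pow_lt {u : ℂ} (hu : ‖u‖ < 1) (n k : ℕ) :
    u * Complex.exp (2 * Real.pi * Complex.I / n) ^ k ∈ Metric.ball (0 : ℂ) 1 := by
  have : ‖Complex.exp (2 * Real.pi * Complex.I / n)‖ = 1 := by
    rw [show 2 * (Real.pi : ℂ) * Complex.I / n = ((2 * Real.pi / n : ℝ) : ℂ) * Complex.I by
      push_cast; ring, Complex.norm_exp_ofReal_mul_I]
  rw [mem_ball_zero_iff, norm_mul, norm_pow, this, one_pow, mul_one]
  exact hu

/-- `coverRoot n` takes each value in the unit disc once: the `n` values `ζᵏ u` and the point in the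
other disc exhaust a fibre of `cover n`. -/
lemma coverRoot_injOn (hn : 1 ≤ n) : ∀ a ∈ Metric.ball (0 : ℂ) (node n),
    ∀ b ∈ Metric.ball (0 : ℂ) (node n), ‖coverRoot n a‖ < 1 → coverRoot n a = coverRoot n b →
      a = b := by
  intro a ha b hb hlt hab
  have hζ := Complex.isPrimitiveRoot_exp n (by omega)
  have key : ∀ a ∈ Metric.ball (0 : ℂ) (node n), coverRoot n a = 0 → a = 0 := by
    intro a ha h
    refine (mul_eq_zero.1 h).resolve_right fun h' => ?_
    rw [Complex.cpow_eq_zero_iff, div_eq_zero_iff] at h'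
    have h1 : 1 - a = 0 := h'.1.resolve_right (scale_ne_zero hn)
    rw [mem_ball_zero_iff, ← sub_eq_zero.1 h1, norm_one] at ha
    exact absurd ha (node_lt_one n).not_gt
  by_cases hu : coverRoot n a = 0
  · rw [key a ha hu, key b hb (hab ▸ hu)]
  · choose β hβ hβ' using fun k => coverRoot_surj hn (norm_mul_pow_lt hlt n k)
    have hlt' : cover n a ∈ Metric.ball (0 : ℂ) 1 := by
      rw [mem_ball_zero_iff, ← coverRoot_pow hn, norm_pow]
      exact pow_lt_one₀ (norm_nonneg _) hlt (by omega)
    obtain ⟨a₁, ha₁, ha₁'⟩ := cover_surj hn hlt'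
    rw [← coverRoot_pow hn a] at ha₁'
    have aux : ∀ c ∈ Metric.ball (0 : ℂ) (node n), coverRoot n c = coverRoot n a → c = β 0 := by
      intro c hc hca
      obtain rfl | ⟨k, hk, rfl⟩ := fibre_eq hn hu hβ hβ' ha₁ ha₁'
        (a := c) (by rw [← coverRoot_pow hn, hca])
      · exact (disjoint_balls hc ha₁).elim
      · rw [hβ'] at hca
        rw [hζ.pow_inj hk (by omega)
          ((mul_right_eq_self₀.1 hca).resolve_right hu |>.trans (pow_zero _).symm)]
    rw [aux a ha rfl, aux b hb hab.symm]

lemma cover_injOn (hn : 1 ≤ n) : ∀ a ∈ Metric.ball (1 : ℂ) (1 - node n),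
    ∀ b ∈ Metric.ball (1 : ℂ) (1 - node n), ‖cover n a‖ < 1 → cover n a = cover n b → a = b := by
  intro a ha b hb hlt hab
  have key : ∀ a ∈ Metric.ball (1 : ℂ) (1 - node n), cover n a = 0 → a = 1 := by
    intro a ha h
    rw [cover, div_eq_zero_iff, or_iff_left (scale_ne_zero hn), mul_eq_zero] at h
    refine (sub_eq_zero.1 (h.resolve_right fun h' => ?_)).symm
    rw [eq_zero_of_pow_eq_zero h'] at ha
    exact disjoint_balls (Metric.mem_ball_self (node_pos hn)) ha
  by_cases hu : cover n a = 0
  · rw [key a ha hu, key b hb (hab ▸ hu)]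
  · obtain ⟨u, hu'⟩ := IsAlgClosed.exists_pow_nat_eq (cover n a) hn
    have hu0 : u ≠ 0 := by
      rintro rfl
      rw [zero_pow (by omega)] at hu'
      exact hu hu'.symm
    have hult : ‖u‖ < 1 := by
      rw [← hu', norm_pow] at hlt
      exact (pow_lt_one_iff_of_nonneg (norm_nonneg _) (by omega)).1 hlt
    choose β hβ hβ' using fun k => coverRoot_surj hn (norm_mul_pow_lt hult n k)
    refine (fibre_eq hn hu0 hβ hβ' hb (hab ▸ hu'.symm) hu'.symm).resolve_right ?_
    rintro ⟨k, -, rfl⟩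
    exact disjoint_balls (hβ k) ha

lemma continuousOn_inner (hn : 1 ≤ n) : ContinuousOn (inner n) (Metric.ball 0 1) :=
  continuousOn_invFunOn (node_pos hn) (fun a ha => analyticAt_coverRoot hn
    ((mem_closedBall_zero_iff.1 ha).trans_lt (node_lt_one n))) (by simp [coverRoot])
    (fun _ => one_le_norm_coverRoot hn) (coverRoot_injOn hn)

lemma continuousOn_outer (hn : 1 ≤ n) : ContinuousOn (outer n) (Metric.ball 0 1) :=
  continuousOn_invFunOn (sub_pos.2 (node_lt_one n)) (fun a _ => analyticAt_cover n a)
    (cover_one n) (fun _ => one_le_norm_cover_of_sphere hn) (cover_injOn hn)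

lemma inner_mem (hn : 1 ≤ n) {u : ℂ} (hu : ‖u‖ < 1) : inner n u ∈ Metric.ball 0 (node n) :=
  Function.invFunOn_mem (coverRoot_surj hn (mem_ball_zero_iff.2 hu))

lemma coverRoot_inner (hn : 1 ≤ n) {u : ℂ} (hu : ‖u‖ < 1) : coverRoot n (inner n u) = u :=
  Function.invFunOn_eq (coverRoot_surj hn (mem_ball_zero_iff.2 hu))

lemma cover_inner (hn : 1 ≤ n) {u : ℂ} (hu : ‖u‖ < 1) : cover n (inner n u) = u ^ n := by
  rw [← coverRoot_pow hn, coverRoot_inner hn hu]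

lemma inner_ne_zero (hn : 1 ≤ n) {u : ℂ} (hu : ‖u‖ < 1) (hu0 : u ≠ 0) : inner n u ≠ 0 := by
  intro h
  have := coverRoot_inner hn hu
  rw [h, coverRoot, zero_mul] at this
  exact hu0 this.symm

lemma inner_ne_node (hn : 1 ≤ n) {u : ℂ} (hu : ‖u‖ < 1) : inner n u ≠ node n := by
  intro h
  have := inner_mem hn hu
  rw [h, mem_ball_zero_iff, Complex.norm_of_nonneg (node_pos hn).le] at this
  exact lt_irrefl _ this

lemma outer_mem (hn : 1 ≤ n) {z : ℂ} (hz : ‖z‖ < 1) : outer n z ∈ Metric.ball 1 (1 - node n) :=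
  Function.invFunOn_mem (cover_surj hn (mem_ball_zero_iff.2 hz))

lemma cover_outer (hn : 1 ≤ n) {z : ℂ} (hz : ‖z‖ < 1) : cover n (outer n z) = z :=
  Function.invFunOn_eq (cover_surj hn (mem_ball_zero_iff.2 hz))

lemma outer_ne_zero (hn : 1 ≤ n) {z : ℂ} (hz : ‖z‖ < 1) : outer n z ≠ 0 := by
  intro h
  have := outer_mem hn hz
  rw [h] at this
  exact disjoint_balls (Metric.mem_ball_self (node_pos hn)) this

lemma outer_ne_node (hn : 1 ≤ n) {z : ℂ} (hz : ‖z‖ < 1) : outer n z ≠ node n := by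
  intro h
  have := cover_outer hn hz
  rw [h, cover_node hn] at this
  rw [← this, norm_one] at hz
  exact lt_irrefl _ hz

lemma outer_cover (hn : 1 ≤ n) {a : ℂ} (ha : a ∈ Metric.ball (1 : ℂ) (1 - node n))
    (h : ‖cover n a‖ < 1) : outer n (cover n a) = a :=
  (cover_injOn hn a ha _ (outer_mem hn h) h (cover_outer hn h).symm).symm

lemma inner_coverRoot (hn : 1 ≤ n) {a : ℂ} (ha : a ∈ Metric.ball (0 : ℂ) (node n))
    (h : ‖coverRoot n a‖ < 1) : inner n (coverRoot n a) = a :=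
  (coverRoot_injOn hn a ha _ (inner_mem hn h) h (coverRoot_inner hn h).symm).symm

lemma outer_zero (hn : 1 ≤ n) : outer n 0 = 1 := by
  have := outer_cover hn (Metric.mem_ball_self (sub_pos.2 (node_lt_one n)))
    (by rw [cover_one, norm_zero]; exact one_pos)
  rwa [cover_one] at this

lemma inner_ne_outer (hn : 1 ≤ n) {u z : ℂ} (hu : ‖u‖ < 1) (hz : ‖z‖ < 1) :
    inner n u ≠ outer n z :=
  fun h => disjoint_balls (inner_mem hn hu) (h ▸ outer_mem hn hz)

/-- The points of the fibre of `cover n` above `uⁿ`, where `0 < ‖u‖ < 1`. -/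
lemma eq_outer_or_eq_inner (hn : 1 ≤ n) {u : ℂ} (hu : ‖u‖ < 1) (hu0 : u ≠ 0) {a : ℂ}
    (ha : cover n a = u ^ n) : a = outer n (u ^ n) ∨
      ∃ k < n, a = inner n (u * Complex.exp (2 * Real.pi * Complex.I / n) ^ k) := by
  have h1 := fun k => mem_ball_zero_iff.1 (norm_mul_pow_lt hu n k)
  have h2 : ‖u ^ n‖ < 1 := by
    rw [norm_pow]; exact pow_lt_one₀ (norm_nonneg _) hu (by omega)
  exact fibre_eq hn hu0 (fun k => inner_mem hn (h1 k)) (fun k => coverRoot_inner hn (h1 k))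
    (outer_mem hn h2) (cover_outer hn h2) ha

/-! ### Going around the movable singularity -/

/-- Near a zero of order two, a holomorphic function is the square of a local coordinate `S`;
the inverse of `S` is `T`. -/
lemma exists_square_coordinate {f g : ℂ → ℂ} {z₀ : ℂ} (hg : AnalyticAt ℂ g z₀) (hg0 : g z₀ ≠ 0)
    (hf : ∀ᶠ z in 𝓝 z₀, f z = (z - z₀) ^ 2 * g z) :
    ∃ S T : ℂ → ℂ, S z₀ = 0 ∧ ContinuousAt S z₀ ∧ AnalyticAt ℂ T 0 ∧
      (∀ᶠ z in 𝓝 z₀, T (S z) = z ∧ S z ^ 2 = f z) ∧ ∀ᶠ s in 𝓝 0, f (T s) = s ^ 2 := by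
  obtain ⟨w, hw⟩ := IsAlgClosed.exists_pow_nat_eq (g z₀) two_pos
  have hw0 : w ≠ 0 := by
    rintro rfl
    exact hg0 (by rw [← hw]; simp)
  let h : ℂ → ℂ := fun z => w * (g z / g z₀) ^ ((2 : ℕ) : ℂ)⁻¹
  have hh : AnalyticAt ℂ h z₀ := by
    refine analyticAt_const.mul (AnalyticAt.cpow hg.div_const analyticAt_const ?_)
    rw [div_self hg0]; exact Complex.one_mem_slitPlane
  have hh0 : h z₀ = w := by simp [h, div_self hg0]
  have hh2 : ∀ z, h z ^ 2 = g z := by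
    intro z
    simp only [h]
    rw [mul_pow, Complex.cpow_nat_inv_pow _ two_ne_zero, hw, mul_div_cancel₀ _ hg0]
  let S : ℂ → ℂ := fun z => (z - z₀) * h z
  have hS : AnalyticAt ℂ S z₀ := (analyticAt_id.sub analyticAt_const).mul hh
  have hS0 : S z₀ = 0 := by simp [S]
  have hSd : deriv S z₀ = w := by
    have := ((hasDerivAt_id z₀).sub_const z₀).mul hh.differentiableAt.hasDerivAt
    have := this.deriv
    simp only [hh0, id, sub_self, zero_mul, add_zero, one_mul] at this
    exact this
  have hne : deriv S z₀ ≠ 0 := hSd ▸ hw0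
  have hTa := hS.analyticAt_localInverse hne
  have hT0 : hS.hasStrictDerivAt.localInverse _ _ _ hne (S z₀) = z₀ :=
    HasStrictFDerivAt.localInverse_apply_image ..
  have hl : ∀ᶠ z in 𝓝 z₀, hS.hasStrictDerivAt.localInverse _ _ _ hne (S z) = z :=
    HasStrictDerivAt.eventually_left_inverse ..
  have hr : ∀ᶠ s in 𝓝 (S z₀), S (hS.hasStrictDerivAt.localInverse _ _ _ hne s) = s :=
    HasStrictDerivAt.eventually_right_inverse ..
  have hSf : ∀ᶠ z in 𝓝 z₀, S z ^ 2 = f z := by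
    filter_upwards [hf] with z hz
    simp only [S]
    rw [mul_pow, hh2, hz]
  generalize hS.hasStrictDerivAt.localInverse _ _ _ hne = T at *
  rw [hS0] at hTa hT0 hr
  refine ⟨S, T, hS0, hS.continuousAt, hTa, hl.and hSf, ?_⟩
  have hc := hTa.continuousAt
  rw [ContinuousAt, hT0] at hc
  filter_upwards [hr, hc.eventually hSf] with s h1 h2
  rw [← h2, h1]

/-- `1 - cover n` has a zero of order two at `node n`. -/
lemma exists_one_sub_cover_eq (hn : 1 ≤ n) : ∃ g : ℂ → ℂ, AnalyticAt ℂ g (node n) ∧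
    g (node n) ≠ 0 ∧ ∀ᶠ z in 𝓝 (node n : ℂ), 1 - cover n z = (z - node n) ^ 2 * g z := by
  have h1 : analyticOrderAt (deriv (cover n)) (node n : ℂ) = (1 : ℕ) := by
    rw [(analyticAt_cover n _).deriv.analyticOrderAt_eq_natCast]
    refine ⟨fun z => -((n + 1) * z ^ (n - 1) / ((1 - node n) * (node n : ℂ) ^ n)), ?_, ?_, ?_⟩
    · fun_prop (disch := exact scale_ne_zero hn)
    · exact neg_ne_zero.2 (div_ne_zero (mul_ne_zero (Nat.cast_add_one_ne_zero n)
        (pow_ne_zero _ (node_ne_zero hn))) (scale_ne_zero hn))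
    · refine Eventually.of_forall fun z => ?_
      rw [(hasDerivAt_cover hn z).deriv, smul_eq_mul]
      ring
  -- The derivative has a simple zero.
  have h2 := (analyticAt_cover n (node n)).analyticOrderAt_deriv_add_one
  rw [h1, cover_node hn] at h2
  obtain ⟨g, hg, hg0, hge⟩ := (((analyticAt_cover n (node n)).sub
    analyticAt_const).analyticOrderAt_eq_natCast (n := 2)).1 h2.symm
  refine ⟨fun z => -g z, hg.neg, neg_ne_zero.2 hg0, ?_⟩
  filter_upwards [hge] with z hz
  rw [smul_eq_mul] at hz
  simp only [Pi.sub_apply] at hz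
  linear_combination -hz

/-- The restriction of `cover n` to the real line. -/
noncomputable def realCover (n : ℕ) (x : ℝ) : ℝ := (1 - x) * x ^ n / ((1 - node n) * node n ^ n)

lemma cover_ofReal (n : ℕ) (x : ℝ) : cover n x = realCover n x := by
  simp [cover, realCover]

lemma hasDerivAt_realCover (hn : 1 ≤ n) (x : ℝ) : HasDerivAt (realCover n)
    ((n + 1) * x ^ (n - 1) * (node n - x) / ((1 - node n) * node n ^ n)) x := by
  have h := (hasDerivAt_cover hn x).real_of_complex
  simp only [cover_ofReal, Complex.ofReal_re] at h
  refine h.congr_deriv ?_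
  rw [← Complex.ofReal_re ((n + 1) * x ^ (n - 1) * (node n - x) / ((1 - node n) * node n ^ n))]
  push_cast
  rfl

lemma continuous_realCover (n : ℕ) : Continuous (realCover n) := by
  unfold realCover; fun_prop

lemma realCover_node (hn : 1 ≤ n) : realCover n (node n) = 1 :=
  div_self (scale_pos hn).ne'

lemma realCover_lt_one_left (hn : 1 ≤ n) {x : ℝ} (h0 : 0 ≤ x) (h1 : x < node n) :
    realCover n x < 1 := by
  have h : StrictMonoOn (realCover n) (Set.Icc 0 (node n)) := by
    refine strictMonoOn_of_deriv_pos (convex_Icc _ _) (continuous_realCover n).continuousOn ?_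
    intro y hy
    rw [interior_Icc] at hy
    rw [(hasDerivAt_realCover hn y).deriv]
    have := hy.1
    have := sub_pos.2 hy.2
    have := scale_pos hn
    positivity
  have := h ⟨h0, h1.le⟩ (Set.right_mem_Icc.2 (node_pos hn).le) h1
  rwa [realCover_node hn] at this

lemma realCover_lt_one_right (hn : 1 ≤ n) {x : ℝ} (h1 : node n < x) :
    realCover n x < 1 := by
  have h : StrictAntiOn (realCover n) (Set.Ici (node n)) := by
    refine strictAntiOn_of_deriv_neg (convex_Ici _) (continuous_realCover n).continuousOn ?_
    intro y hy
    rw [interior_Ici, Set.mem_Ioi] at hy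
    rw [(hasDerivAt_realCover hn y).deriv]
    have h2 := sub_neg.2 hy
    have h3 := (node_pos hn).trans hy
    exact div_neg_of_neg_of_pos (mul_neg_of_pos_of_neg (by positivity) h2) (scale_pos hn)
  have := h Set.self_mem_Ici h1.le h1
  rwa [realCover_node hn] at this

/-- The real `n`-th root of `z`, as a complex number. -/
noncomputable def realRoot (n : ℕ) (z : ℝ) : ℂ := ((z ^ ((n : ℝ)⁻¹) : ℝ) : ℂ)

lemma realRoot_pow (hn : 1 ≤ n) {z : ℝ} (hz : 0 ≤ z) : realRoot n z ^ n = z := by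
  rw [realRoot, ← Complex.ofReal_pow, Real.rpow_inv_natCast_pow hz (by omega)]

lemma norm_realRoot_lt (hn : 1 ≤ n) {z : ℝ} (hz : 0 ≤ z) (hz1 : z < 1) : ‖realRoot n z‖ < 1 := by
  rw [realRoot, Complex.norm_of_nonneg (Real.rpow_nonneg hz _)]
  exact Real.rpow_lt_one hz hz1 (by positivity)

lemma realRoot_ne_zero {z : ℝ} (hz : 0 < z) : realRoot n z ≠ 0 := by
  rw [realRoot]
  exact_mod_cast (Real.rpow_pos_of_pos hz _).ne'

lemma continuous_realRoot (n : ℕ) : Continuous (realRoot n) :=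
  Complex.continuous_ofReal.comp (Real.continuous_rpow_const (by positivity))

lemma outer_realCover (hn : 1 ≤ n) {x : ℝ} (h0 : node n < x) (h1 : x < 1) :
    outer n (realCover n x) = x := by
  have h2 : (x : ℂ) ∈ Metric.ball (1 : ℂ) (1 - node n) := by
    rw [mem_ball_iff_norm, norm_sub_rev, ← Complex.ofReal_one, ← Complex.ofReal_sub,
      Complex.norm_of_nonneg (by linarith)]
    linarith
  rw [← cover_ofReal]
  refine outer_cover hn h2 ?_
  have h3 : 0 ≤ realCover n x := div_nonneg
    (mul_nonneg (by linarith) (pow_nonneg ((node_pos hn).trans h0).le _)) (scale_pos hn).le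
  rw [cover_ofReal, Complex.norm_of_nonneg h3]
  exact realCover_lt_one_right hn h0

lemma inner_realRoot_realCover (hn : 1 ≤ n) {x : ℝ} (h0 : 0 < x) (h1 : x < node n) :
    inner n (realRoot n (realCover n x)) = x := by
  have hx1 : 0 < 1 - x := by linarith [node_lt_one n]
  have hM := scale_pos hn
  have h3 : 0 < realCover n x := div_pos (mul_pos hx1 (pow_pos h0 _)) hM
  have h2 : (x : ℂ) ∈ Metric.ball (0 : ℂ) (node n) := by
    rwa [mem_ball_zero_iff, Complex.norm_of_nonneg h0.le]
  have h4 : coverRoot n x = realRoot n (realCover n x) := by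
    have e : coverRoot n x = ((x * ((1 - x) / ((1 - node n) * node n ^ n)) ^ (n : ℝ)⁻¹ : ℝ) : ℂ) := by
      rw [coverRoot, Complex.ofReal_mul, Complex.ofReal_cpow (by positivity)]
      push_cast
      rfl
    rw [e, realRoot]
    congr 1
    refine (pow_left_inj₀ (by positivity) (by positivity) (show n ≠ 0 by omega)).1 ?_
    rw [mul_pow, Real.rpow_inv_natCast_pow (by positivity) (by omega),
      Real.rpow_inv_natCast_pow h3.le (by omega), realCover]
    ring
  rw [← h4]
  refine inner_coverRoot hn h2 ?_
  rw [h4]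
  exact norm_realRoot_lt hn h3.le (realCover_lt_one_left hn h0.le h1)

/-- For some small circle around the critical value `1`, one turn leads from the parameter to the
right of `node n` to the parameter to its left. -/
lemma exists_small_loop (hn : 1 ≤ n) : ∃ r : ℝ, 0 < r ∧ r < 1 ∧
    ∃ ℓ : Path (outer n ((1 - r : ℝ) : ℂ)) (inner n (realRoot n (1 - r))), ∀ t,
      cover n (ℓ t) = 1 - r * Complex.exp (2 * Real.pi * Complex.I * ((t : ℝ) : ℂ)) := by
  obtain ⟨g, hg, hg0, hge⟩ := exists_one_sub_cover_eq hn
  obtain ⟨S, T, hS0, hSc, hTa, hST, hTf⟩ := exists_square_coordinate hg hg0 hge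
  obtain ⟨δ, hδ, hball⟩ := Metric.eventually_nhds_iff_ball.1
    (hTf.and hTa.eventually_continuousAt)
  obtain ⟨η, hη, hball'⟩ := Metric.eventually_nhds_iff_ball.1
    (hST.and (hSc.eventually (show Metric.ball 0 δ ∈ 𝓝 (S (node n)) from
      hS0.symm ▸ Metric.ball_mem_nhds (0 : ℂ) hδ)))
  have hα := node_pos hn
  have hα1 := node_lt_one n
  obtain ⟨η', hη'0, hη'⟩ : ∃ η' > 0, η' < η ∧ η' < node n ∧ η' < 1 - node n :=
    ⟨min η (min (node n) (1 - node n)) / 2, by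
      have : 0 < 1 - node n := by linarith
      positivity, by
      have : 0 < min η (min (node n) (1 - node n)) := lt_min hη (lt_min hα (by linarith))
      have := min_le_left η (min (node n) (1 - node n))
      have := (min_le_right η (min (node n) (1 - node n))).trans (min_le_left _ _)
      have := (min_le_right η (min (node n) (1 - node n))).trans (min_le_right _ _)
      refine ⟨?_, ?_, ?_⟩ <;> linarith⟩
  -- Two real points on either side of `node n` with the same image `z`, slightly less than `1`.
  have hL := realCover_lt_one_left hn (x := node n - η') (by linarith) (by linarith)
  have hR := realCover_lt_one_right hn (x := node n + η') (by linarith)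
  obtain ⟨z, hz, hz1⟩ := exists_between
    (max_lt (max_lt hL hR) (zero_lt_one (α := ℝ)))
  obtain ⟨⟨hzL, hzR⟩, hz0⟩ := (max_lt_iff.1 hz).imp_left max_lt_iff.1
  obtain ⟨x₁, hx₁, hx₁z⟩ := intermediate_value_Ioo (by linarith)
    (continuous_realCover n).continuousOn
    (show z ∈ Set.Ioo (realCover n (node n - η')) (realCover n (node n)) by
      rw [realCover_node hn]; exact ⟨hzL, hz1⟩)
  obtain ⟨x₂, hx₂, hx₂z⟩ := intermediate_value_Ioo' (by linarith)
    (continuous_realCover n).continuousOn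
    (show z ∈ Set.Ioo (realCover n (node n + η')) (realCover n (node n)) by
      rw [realCover_node hn]; exact ⟨hzR, hz1⟩)
  have hmem : ∀ x : ℝ, |x - node n| < η → (x : ℂ) ∈ Metric.ball (node n : ℂ) η := by
    intro x hx
    rwa [mem_ball_iff_norm, ← Complex.ofReal_sub, Complex.norm_real, Real.norm_eq_abs]
  obtain ⟨⟨hT₁, hS₁⟩, -⟩ := hball' x₁ (hmem x₁ (abs_lt.2 ⟨by linarith [hx₁.1], by linarith [hx₁.2]⟩))
  obtain ⟨⟨hT₂, hS₂⟩, hSδ⟩ := hball' x₂ (hmem x₂ (abs_lt.2 ⟨by linarith [hx₂.1], by linarith [hx₂.2]⟩))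
  rw [cover_ofReal, hx₁z] at hS₁
  rw [cover_ofReal, hx₂z] at hS₂
  have hneg : S x₁ = -S x₂ := by
    refine (sq_eq_sq_iff_eq_or_eq_neg.1 (hS₁.trans hS₂.symm)).resolve_left fun h => ?_
    rw [h, hT₂, Complex.ofReal_inj] at hT₁
    linarith [hx₁.2, hx₂.1]
  -- Half a turn of the square root `S` of `1 - cover n` is one turn of `cover n`.
  have hexp : ∀ t : ℝ, S x₂ * Complex.exp (t * Real.pi * Complex.I) ∈ Metric.ball (0 : ℂ) δ := by
    intro t
    rw [mem_ball_zero_iff, norm_mul, ← Complex.ofReal_mul, Complex.norm_exp_ofReal_mul_I, mul_one]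
    exact mem_ball_zero_iff.1 hSδ
  refine ⟨1 - z, by linarith, by linarith, ⟨⟨fun t =>
    T (S x₂ * Complex.exp (((t : ℝ) : ℂ) * Real.pi * Complex.I)), ?_⟩, ?_, ?_⟩, ?_⟩
  · rw [continuous_iff_continuousAt]
    intro t
    exact ContinuousAt.comp (f := fun t : unitInterval =>
      S x₂ * Complex.exp (((t : ℝ) : ℂ) * Real.pi * Complex.I)) (hball _ (hexp t)).2 (by fun_prop)
  · have h : x₂ < 1 := by linarith [hx₂.2]
    simp only [sub_sub_cancel]
    rw [← hx₂z, outer_realCover hn hx₂.1 h]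
    simpa using hT₂
  · have h : 0 < x₁ := by linarith [hx₁.1]
    simp only [sub_sub_cancel]
    rw [← hx₁z, inner_realRoot_realCover hn h hx₁.2]
    simpa [← hneg] using hT₁
  · intro t
    have h := (hball _ (hexp t)).1
    rw [mul_pow, hS₂, ← Complex.exp_nat_mul] at h
    rw [Path.coe_mk_mk]
    have e : ((2 : ℕ) : ℂ) * (((t : ℝ) : ℂ) * Real.pi * Complex.I) =
      2 * Real.pi * Complex.I * ((t : ℝ) : ℂ) := by push_cast; ring
    rw [e] at h
    push_cast
    linear_combination -h

/-- Two continuous families of parameters with the same images under `cover n` agree everywhere if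
they agree somewhere. -/
lemma eq_of_cover_eq (hn : 1 ≤ n) {X : Type*} [TopologicalSpace X] [PreconnectedSpace X]
    {F G : X → ℂ} (hF : Continuous F) (hG : Continuous G) (h : ∀ x, cover n (F x) = cover n (G x))
    (h0 : ∀ x, F x ≠ 0) (h1 : ∀ x, F x ≠ node n) {x₀ : X} (hx₀ : F x₀ = G x₀) (x : X) :
    F x = G x := by
  have hclosed : IsClosed {x | F x = G x} := isClosed_eq hF hG
  have hopen : IsOpen {x | F x = G x} := by
    rw [isOpen_iff_mem_nhds]
    intro x hx
    have hL := (localInv_spec hn (h0 x) (h1 x)).2.2.1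
    have hx' : F x = G x := hx
    filter_upwards [hF.continuousAt.eventually hL,
      (hG.continuousAt (x := x)).eventually (hx' ▸ hL : ∀ᶠ b in 𝓝 (G x), localInv n (F x) (cover n b) = b)]
      with y hy1 hy2
    rw [h y] at hy1
    exact hy1.symm.trans hy2
  have := IsClopen.eq_univ ⟨hclosed, hopen⟩ ⟨x₀, hx₀⟩
  exact (Set.ext_iff.1 this x).2 trivial

lemma isCoveringMapOn_cover (hn : 1 ≤ n) : IsCoveringMapOn (cover n) {0, 1}ᶜ := by
  open Polynomial in
  let q : ℂ[X] := (1 - X) * X ^ n * C ((1 - node n) * (node n : ℂ) ^ n)⁻¹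
  have hq : q.eval = cover n := by
    funext a
    simp only [q, cover, div_eq_mul_inv, Polynomial.eval_mul, Polynomial.eval_sub,
      Polynomial.eval_one, Polynomial.eval_X, Polynomial.eval_pow, Polynomial.eval_C]
  have h := q.isCoveringMapOn_eval
  rw [hq] at h
  refine h.mono (Set.compl_subset_compl.2 ?_)
  rintro _ ⟨a, ha, rfl⟩
  have ha' : q.derivative.eval a = 0 := ha
  have hd := q.hasDerivAt a
  simp only [hq] at hd
  rw [ha'] at hd
  by_contra hne
  simp only [Set.mem_insert_iff, Set.mem_singleton_iff, not_or] at hne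
  refine deriv_cover_ne_zero hn (fun h => hne.1 ?_) (fun h => hne.2 ?_)
    ((hasDerivAt_cover hn a).unique hd)
  · rw [h, cover_zero hn]
  · rw [h, cover_node hn]

lemma one_sub_mul_exp_mem {r : ℝ} (h0 : 0 < r) (h1 : r < 1) (t : ℝ) :
    1 - r * Complex.exp (2 * Real.pi * Complex.I * (t : ℂ)) ∈ ({0, 1}ᶜ : Set ℂ) := by
  simp only [Set.mem_compl_iff, Set.mem_insert_iff, Set.mem_singleton_iff, not_or]
  constructor
  · intro h
    have h2 : ‖(r : ℂ) * Complex.exp (2 * Real.pi * Complex.I * (t : ℂ))‖ = 1 := by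
      rw [← sub_eq_zero.1 h, norm_one]
    rw [norm_mul, show 2 * (Real.pi : ℂ) * Complex.I * (t : ℂ) =
      ((2 * Real.pi * t : ℝ) : ℂ) * Complex.I by push_cast; ring, Complex.norm_exp_ofReal_mul_I,
      Complex.norm_of_nonneg h0.le, mul_one] at h2
    linarith
  · simp [h0.ne', Complex.exp_ne_zero]

/-- One turn around the critical value `1`, on any circle of radius less than `1`, leads from
`outer n (1 - r)` to the real parameter `inner n (1 - r)^(1/n)`. -/
lemma exists_loop (hn : 1 ≤ n) {r : ℝ} (hr0 : 0 < r) (hr1 : r < 1) :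
    ∃ ℓ : Path (outer n ((1 - r : ℝ) : ℂ)) (inner n (realRoot n (1 - r))), ∀ t,
      cover n (ℓ t) = 1 - r * Complex.exp (2 * Real.pi * Complex.I * ((t : ℝ) : ℂ)) := by
  obtain ⟨r₁, h0, h1, ℓ, hℓ⟩ := exists_small_loop hn
  let ρ : ℝ → ℝ := fun s => r₁ + (Set.projIcc (0 : ℝ) 1 zero_le_one s : ℝ) * (r - r₁)
  have hρc : Continuous ρ := by fun_prop
  have hρ0 : ρ 0 = r₁ := by simp [ρ]
  have hρ1 : ρ 1 = r := by simp [ρ]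
  have hρ : ∀ s, 0 < ρ s ∧ ρ s < 1 := fun s =>
    (convex_Ioo (0 : ℝ) 1).add_smul_sub_mem ⟨h0, h1⟩ ⟨hr0, hr1⟩
      (Set.projIcc (0 : ℝ) 1 zero_le_one s).2
  -- The homotopy from the circle of radius `r₁` to that of radius `r`; `t ↦ F (1, t)` is the lift
  -- sought, once the other three sides of the square have been identified.
  let f : C(ℝ × ℝ, ℂ) := ⟨fun x => 1 - ρ x.1 * Complex.exp (2 * Real.pi * Complex.I * (x.2 : ℂ)),
    by fun_prop⟩
  have hnorm : ∀ s, ‖((1 - ρ s : ℝ) : ℂ)‖ < 1 := by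
    intro s
    rw [Complex.norm_of_nonneg (by linarith [(hρ s).2])]
    linarith [(hρ s).1]
  obtain ⟨F, ⟨hF0, hF⟩, -⟩ := (isCoveringMapOn_cover hn).existsUnique_continuousMap_lifts f
    (a₀ := (0, 0)) (e₀ := outer n ((1 - ρ 0 : ℝ) : ℂ))
    (by rw [cover_outer hn (hnorm 0)]; simp [f])
    (fun x => one_sub_mul_exp_mem (hρ x.1).1 (hρ x.1).2 x.2)
  have hFc : ∀ s t : ℝ, cover n (F (s, t)) =
      1 - ρ s * Complex.exp (2 * Real.pi * Complex.I * (t : ℂ)) := fun s t => congr_fun hF (s, t)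
  have hne0 : ∀ s t, F (s, t) ≠ 0 := by
    intro s t h
    have h2 := one_sub_mul_exp_mem (hρ s).1 (hρ s).2 t
    rw [← hFc, h, cover_zero hn] at h2
    simp at h2
  have hne1 : ∀ s t, F (s, t) ≠ node n := by
    intro s t h
    have h2 := one_sub_mul_exp_mem (hρ s).1 (hρ s).2 t
    rw [← hFc, h, cover_node hn] at h2
    simp at h2
  have hFcont := F.continuous
  have e1 : F (0, 1) = inner n (realRoot n (1 - r₁)) := by
    have := eq_of_cover_eq hn (F := fun t : unitInterval => F (0, (t : ℝ))) (G := ℓ)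
      (by fun_prop) ℓ.continuous (fun t => by rw [hFc, hℓ, hρ0]) (fun _ => hne0 _ _)
      (fun _ => hne1 _ _) (x₀ := 0) (by simp [hF0, hρ0]) 1
    simpa using this
  have e2 : F (1, 0) = outer n ((1 - r : ℝ) : ℂ) := by
    have hc : Continuous fun s => outer n ((1 - ρ s : ℝ) : ℂ) :=
      (continuousOn_outer hn).comp_continuous (by fun_prop)
        (fun s => mem_ball_zero_iff.2 (hnorm s))
    have := eq_of_cover_eq hn (F := fun s : ℝ => F (s, 0)) (by fun_prop) hc
      (fun s => by rw [hFc, cover_outer hn (hnorm s)]; simp) (fun _ => hne0 _ _)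
      (fun _ => hne1 _ _) (x₀ := 0) hF0 1
    simpa [hρ1] using this
  have e3 : F (1, 1) = inner n (realRoot n (1 - r)) := by
    have hlt : ∀ s, ‖realRoot n (1 - ρ s)‖ < 1 := fun s =>
      norm_realRoot_lt hn (by linarith [(hρ s).2]) (by linarith [(hρ s).1])
    have hc : Continuous fun s => inner n (realRoot n (1 - ρ s)) :=
      (continuousOn_inner hn).comp_continuous
        ((continuous_realRoot n).comp (by fun_prop)) (fun s => mem_ball_zero_iff.2 (hlt s))
    have := eq_of_cover_eq hn (F := fun s : ℝ => F (s, 1)) (by fun_prop) hc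
      (fun s => by
        rw [hFc, cover_inner hn (hlt s), realRoot_pow hn (by linarith [(hρ s).2])]
        simp) (fun _ => hne0 _ _) (fun _ => hne1 _ _) (x₀ := 0) (by rw [e1, hρ0]) 1
    rw [this, hρ1]
  refine ⟨⟨⟨fun t => F (1, (t : ℝ)), by fun_prop⟩, by simpa using e2, by simpa using e3⟩, ?_⟩
  intro t
  rw [Path.coe_mk_mk, hFc, hρ1]

/-! ### Irreducibility of the solution curve -/

lemma inner_inj (hn : 1 ≤ n) {u w : ℂ} (hu : ‖u‖ < 1) (hw : ‖w‖ < 1) (h : inner n u = inner n w) :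
    u = w := by
  rw [← coverRoot_inner hn hu, h, coverRoot_inner hn hw]

/-- The fibre of `cover n` above a point of the punctured unit disc has `n + 1` elements. -/
lemma exists_fibre_finset (hn : 1 ≤ n) {z : ℂ} (hz0 : z ≠ 0) (hz : ‖z‖ < 1) :
    ∃ s : Finset ℂ, s.card = n + 1 ∧ ∀ a ∈ s, cover n a = z ∧ a ≠ 0 ∧ a ≠ node n := by
  obtain ⟨u, hu⟩ := IsAlgClosed.exists_pow_nat_eq z hn
  have hζ := Complex.isPrimitiveRoot_exp n (by omega)
  have hu0 : u ≠ 0 := by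
    rintro rfl
    rw [zero_pow (by omega)] at hu
    exact hz0 hu.symm
  have hult : ‖u‖ < 1 := by
    rw [← hu, norm_pow] at hz
    exact (pow_lt_one_iff_of_nonneg (norm_nonneg _) (by omega)).1 hz
  have hk := fun k => mem_ball_zero_iff.1 (norm_mul_pow_lt hult n k)
  set ζ := Complex.exp (2 * Real.pi * Complex.I / n)
  have hinj : Set.InjOn (fun k => inner n (u * ζ ^ k)) (Finset.range n) := by
    intro i hi j hj hij
    exact hζ.pow_inj (by simpa using hi) (by simpa using hj)
      (mul_left_cancel₀ hu0 (inner_inj hn (hk i) (hk j) hij))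
  have hcov : ∀ k, cover n (inner n (u * ζ ^ k)) = z := by
    intro k
    rw [cover_inner hn (hk k), mul_pow, ← pow_mul, mul_comm k, pow_mul, hζ.pow_eq_one, one_pow,
      mul_one, hu]
  refine ⟨insert (outer n z) ((Finset.range n).image fun k => inner n (u * ζ ^ k)), ?_, ?_⟩
  · rw [Finset.card_insert_of_notMem, Finset.card_image_of_injOn hinj, Finset.card_range]
    simp only [Finset.mem_image, not_exists, not_and]
    exact fun k _ => inner_ne_outer hn (hk k) hz
  · simp only [Finset.mem_insert, Finset.mem_image]
    rintro a (rfl | ⟨k, -, rfl⟩)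
    · exact ⟨cover_outer hn hz, outer_ne_zero hn hz, outer_ne_node hn hz⟩
    · exact ⟨hcov k, inner_ne_zero hn (hk k)
        (mul_ne_zero hu0 (pow_ne_zero _ (Complex.exp_ne_zero _))), inner_ne_node hn (hk k)⟩

lemma aeval_curvePolynomial (z : Fin 2 → ℂ) :
    MvPolynomial.aeval z (curvePolynomial n y₀) =
      z 1 * (1 - z 0 * z 1 / v₁ n) ^ n - y₀ * (1 - z 0 * z 1 / v₂ n) ^ (n + 1) := by
  simp [curvePolynomial, div_eq_inv_mul]

lemma eta_fin_two (z : Fin 2 → ℂ) : ![z 0, z 1] = z := by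
  ext i; fin_cases i <;> rfl

lemma mem_solutionCurve_iff_aeval (hn : 1 ≤ n) (z : Fin 2 → ℂ) :
    z ∈ solutionCurve n y₀ ↔ MvPolynomial.aeval z (curvePolynomial n y₀) = 0 := by
  obtain ⟨x, y, rfl⟩ : ∃ x y, z = ![x, y] := ⟨z 0, z 1, (eta_fin_two z).symm⟩
  rw [aeval_curvePolynomial, mem_solutionCurve, sub_eq_zero]
  refine and_iff_right_of_imp fun h hq => ?_
  -- On `xy = v₂` the polynomial is `y (1 - v₂/v₁)ⁿ`, and `y ≠ 0` there.
  rw [hq, zero_pow (Nat.succ_ne_zero n), mul_zero, mul_eq_zero] at h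
  rcases h with h | h
  · rw [h, mul_zero, zero_div, sub_zero] at hq
    exact one_ne_zero hq
  · have hp := eq_zero_of_pow_eq_zero h
    have h1 := two_mul_add_one_ne_zero n
    rw [div_v₁ hn] at hp
    rw [div_v₂] at hq
    have : (1 : ℂ) = 0 := by
      linear_combination (n + 1) * hp - n * hq
    exact one_ne_zero this

lemma solutionCurve_eq_zeroLocus (hn : 1 ≤ n) :
    solutionCurve n y₀ = MvPolynomial.zeroLocus ℂ (Ideal.span {curvePolynomial n y₀}) := by
  ext z
  rw [MvPolynomial.zeroLocus_span, mem_solutionCurve_iff_aeval hn]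
  simp

/-- The curve is irreducible because it is parametrised by the plane with two points removed. -/
lemma isIrreducible_solutionCurve (hn : 1 ≤ n) (hy₀ : y₀ ≠ 0) :
    IsIrreducibleAlgebraicSet (solutionCurve n y₀) := by
  refine ⟨⟨_, solutionCurve_eq_zeroLocus hn⟩, ⟨_, param_mem_solutionCurve hn hy₀ (a := 1)
    one_ne_zero ?_⟩, ?_⟩
  · exact_mod_cast (node_lt_one n).ne'
  rintro _ _ ⟨I, rfl⟩ ⟨J, rfl⟩ hsub
  by_contra! h
  obtain ⟨⟨z, hz, hzI⟩, ⟨w, hw, hwJ⟩⟩ := h.imp Set.not_subset.1 Set.not_subset.1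
  rw [MvPolynomial.mem_zeroLocus_iff] at hzI hwJ
  push Not at hzI hwJ
  obtain ⟨f, hfI, hf⟩ := hzI
  obtain ⟨g, hgJ, hg⟩ := hwJ
  let U : Set ℂ := {0, (node n : ℂ)}ᶜ
  have hU : ∀ a ∈ U, a ≠ 0 ∧ a ≠ node n := fun a ha => by simpa [U, not_or] using ha
  have hUc : IsPreconnected U :=
    ((Set.toFinite {0, (node n : ℂ)}).countable.isConnected_compl_of_one_lt_rank
      (by simp)).isPreconnected
  let P : ℂ → Fin 2 → ℂ := fun a => ![movableSingularity n y₀ * cover n a, ordinate n y₀ a]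
  have hP : ∀ h : MvPolynomial (Fin 2) ℂ,
      AnalyticOnNhd ℂ (fun a => MvPolynomial.aeval (P a) h) U := by
    intro h a ha
    refine AnalyticAt.aeval_mvPolynomial (fun i => ?_) h
    fin_cases i
    · exact analyticAt_const.mul (analyticAt_cover n a)
    · exact analyticAt_ordinate (hU a ha).1 (hU a ha).2
  have hPsurj : ∀ z ∈ solutionCurve n y₀, ∃ a ∈ U, P a = z := by
    intro z hz
    rw [← eta_fin_two z] at hz ⊢
    refine ⟨parameter n (z 0) (z 1), ?_, ?_⟩
    · simp only [U, Set.mem_compl_iff, Set.mem_insert_iff, Set.mem_singleton_iff, not_or]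
      exact ⟨parameter_ne_zero hn hy₀ hz, parameter_ne_node hn hz⟩
    · simp only [P]
      rw [cover_parameter hn hy₀ hz, ordinate_parameter hn hy₀ hz,
        mul_div_cancel₀ _ (movableSingularity_ne_zero hn hy₀)]
  have hprod : ∀ a ∈ U, MvPolynomial.aeval (P a) f = 0 ∨ MvPolynomial.aeval (P a) g = 0 := by
    intro a ha
    have := hsub (param_mem_solutionCurve hn hy₀ (hU a ha).1 (hU a ha).2)
    simp only [Set.mem_union, MvPolynomial.mem_zeroLocus_iff] at this
    exact this.imp (fun h => h f hfI) (fun h => h g hgJ)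
  obtain ⟨a, ha, rfl⟩ := hPsurj z hz
  obtain ⟨b, hb, rfl⟩ := hPsurj w hw
  have hUo : IsOpen U := (Set.toFinite {0, (node n : ℂ)}).isClosed.isOpen_compl
  have hev : (fun a => MvPolynomial.aeval (P a) g) =ᶠ[𝓝 a] 0 := by
    filter_upwards [(hP f a ha).continuousAt.eventually_ne hf, hUo.mem_nhds ha] with d hd hdU
    exact (hprod d hdU).resolve_left hd
  exact hg ((hP g).eqOn_zero_of_preconnected_of_eventuallyEq_zero hUc ha hev hb)

open Polynomial in
/-- The restriction of a polynomial in two variables to a vertical line. -/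
noncomputable def slice (f : MvPolynomial (Fin 2) ℂ) (x : ℂ) : ℂ[X] :=
  MvPolynomial.aeval ![C x, X] f

lemma eval_slice (f : MvPolynomial (Fin 2) ℂ) (x y : ℂ) :
    (slice f x).eval y = MvPolynomial.aeval ![x, y] f := by
  rw [slice, ← Polynomial.coe_aeval_eq_eval, MvPolynomial.comp_aeval_apply]
  congr 2
  ext i
  fin_cases i <;> simp

lemma natDegree_slice_curvePolynomial_le (x : ℂ) :
    (slice (curvePolynomial n y₀) x).natDegree ≤ n + 1 := by
  simp only [slice, curvePolynomial, map_sub, map_mul, map_pow, map_one, MvPolynomial.aeval_X,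
    MvPolynomial.aeval_C, Matrix.cons_val_zero, Matrix.cons_val_one, Polynomial.algebraMap_eq]
  compute_degree
  exact (add_comm 1 n).le

/-- A factor of the polynomial of the curve is constant if the other factor vanishes on the
curve. -/
lemma isUnit_of_curvePolynomial_eq_mul (hn : 1 ≤ n) (hy₀ : y₀ ≠ 0)
    {f g : MvPolynomial (Fin 2) ℂ} (hfg : curvePolynomial n y₀ = f * g)
    (hf : ∀ z ∈ solutionCurve n y₀, MvPolynomial.aeval z f = 0) : IsUnit g := by
  have hx₀ := movableSingularity_ne_zero hn hy₀
  -- On the line `y = 0` the polynomial of the curve is the constant `-y₀`.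
  have hval : ∀ x : ℂ, MvPolynomial.aeval ![x, 0] f * MvPolynomial.aeval ![x, 0] g = -y₀ := by
    intro x
    rw [← map_mul, ← hfg, aeval_curvePolynomial]
    simp
  -- Above `x` the curve has `n + 1` points, so `f` has degree `n + 1` in `y`.
  have hdeg : ∀ x : ℂ, x ≠ 0 → ‖x / movableSingularity n y₀‖ < 1 → ∀ y,
      MvPolynomial.aeval ![x, y] g = MvPolynomial.aeval ![x, 0] g := by
    intro x hx hx1 y
    obtain ⟨s, hs, hsx⟩ := exists_fibre_finset hn (div_ne_zero hx hx₀) hx1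
    have hmem : ∀ a ∈ s, ![x, ordinate n y₀ a] ∈ solutionCurve n y₀ := by
      intro a ha
      have h := param_mem_solutionCurve hn hy₀ (hsx a ha).2.1 (hsx a ha).2.2
      rwa [(hsx a ha).1, mul_div_cancel₀ _ hx₀] at h
    have hinj : Set.InjOn (ordinate n y₀) s := by
      intro a ha b hb hab
      have h1 := parameter_param hn hy₀ (hsx a ha).2.1 (hsx a ha).2.2
      have h2 := parameter_param hn hy₀ (hsx b hb).2.1 (hsx b hb).2.2
      rw [← h1, ← h2, (hsx a ha).1, (hsx b hb).1, hab]
    have hmul : slice (curvePolynomial n y₀) x = slice f x * slice g x := by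
      rw [hfg]; exact map_mul _ _ _
    have hne : slice f x * slice g x ≠ 0 := by
      intro h
      have := hval x
      rw [← eval_slice, ← eval_slice, ← Polynomial.eval_mul, h, Polynomial.eval_zero] at this
      exact hy₀ (neg_eq_zero.1 this.symm)
    have hf0 := left_ne_zero_of_mul hne
    have h1 : n + 1 ≤ (slice f x).natDegree := by
      rw [← hs, ← Finset.card_image_of_injOn hinj]
      refine Polynomial.card_le_degree_of_subset_roots fun b hb => ?_
      obtain ⟨a, ha, rfl⟩ := Finset.mem_image.1 hb
      rw [Polynomial.mem_roots hf0, Polynomial.IsRoot, eval_slice]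
      exact hf _ (hmem a ha)
    have h2 := natDegree_slice_curvePolynomial_le (n := n) (y₀ := y₀) x
    rw [hmul, Polynomial.natDegree_mul hf0 (right_ne_zero_of_mul hne)] at h2
    rw [← eval_slice, ← eval_slice, Polynomial.eq_C_of_natDegree_eq_zero
      (show (slice g x).natDegree = 0 by omega), Polynomial.eval_C, Polynomial.eval_C]
  have hall : ∀ x y : ℂ, MvPolynomial.aeval ![x, y] g = MvPolynomial.aeval ![x, 0] g := by
    intro x y
    have han : ∀ y : ℂ, AnalyticOnNhd ℂ (fun x : ℂ => MvPolynomial.aeval ![x, y] g) Set.univ := by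
      intro y x _
      refine AnalyticAt.aeval_mvPolynomial (fun i => ?_) g
      fin_cases i
      · exact analyticAt_id
      · exact analyticAt_const
    have hev : (fun x : ℂ => MvPolynomial.aeval ![x, y] g)
        =ᶠ[𝓝 (movableSingularity n y₀ / 2)] fun x => MvPolynomial.aeval ![x, 0] g := by
      have hc : ContinuousAt (fun x : ℂ => ‖x / movableSingularity n y₀‖)
          (movableSingularity n y₀ / 2) := by
        fun_prop (disch := assumption)
      have hlt : ‖movableSingularity n y₀ / 2 / movableSingularity n y₀‖ < 1 := by
        rw [div_div_cancel_left' hx₀, norm_inv]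
        norm_num
      filter_upwards [hc.eventually_lt_const hlt,
        continuousAt_id.eventually_ne (div_ne_zero hx₀ two_ne_zero)] with x h1 h2
      exact hdeg x h2 h1 y
    exact congr_fun ((han y).eq_of_eventuallyEq (han 0) hev) x
  have hroot : ∀ x : ℂ, MvPolynomial.aeval ![x, 0] g ≠ 0 := by
    intro x h
    have := hval x
    rw [h, mul_zero] at this
    exact hy₀ (neg_eq_zero.1 this.symm)
  -- A polynomial in `x` without zeros is constant.
  open Polynomial in
  let q : ℂ[X] := MvPolynomial.aeval ![X, 0] g
  have hq : ∀ x, q.eval x = MvPolynomial.aeval ![x, 0] g := by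
    intro x
    simp only [q]
    rw [← Polynomial.coe_aeval_eq_eval, MvPolynomial.comp_aeval_apply]
    congr 2
    ext i
    fin_cases i <;> simp
  have hqdeg : q.degree ≤ 0 := by
    by_contra! h
    obtain ⟨x, hx⟩ := IsAlgClosed.exists_root q h.ne'
    exact hroot x ((hq x).symm.trans hx)
  have hg : g = MvPolynomial.C (q.coeff 0) := by
    refine MvPolynomial.funext fun z => ?_
    rw [MvPolynomial.eval_C, ← MvPolynomial.coe_aeval_eq_eval, ← eta_fin_two z]
    refine (hall _ _).trans ?_
    rw [← hq, Polynomial.eq_C_of_degree_le_zero hqdeg, Polynomial.eval_C, Polynomial.coeff_C_zero]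
  rw [hg]
  refine IsUnit.map MvPolynomial.C (isUnit_iff_ne_zero.2 fun h => hroot 0 ?_)
  rw [hg, h, map_zero, map_zero]

lemma irreducible_curvePolynomial (hn : 1 ≤ n) (hy₀ : y₀ ≠ 0) :
    Irreducible (curvePolynomial n y₀) := by
  obtain ⟨-, ⟨z, hz⟩, hirr⟩ := isIrreducible_solutionCurve hn hy₀
  refine irreducible_iff.2 ⟨fun hu => ?_, fun f g hfg => ?_⟩
  · rw [mem_solutionCurve_iff_aeval hn] at hz
    exact (hu.map (MvPolynomial.aeval z)).ne_zero hz
  · have hsub : solutionCurve n y₀ ⊆ MvPolynomial.zeroLocus ℂ (Ideal.span {f}) ∪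
        MvPolynomial.zeroLocus ℂ (Ideal.span {g}) := by
      intro z hz
      rw [mem_solutionCurve_iff_aeval hn, hfg, map_mul, mul_eq_zero] at hz
      simpa [MvPolynomial.zeroLocus_span] using hz
    rcases hirr _ _ ⟨_, rfl⟩ ⟨_, rfl⟩ hsub with h | h
    · exact Or.inr (isUnit_of_curvePolynomial_eq_mul hn hy₀ hfg fun z hz => by
        simpa [MvPolynomial.zeroLocus_span] using h hz)
    · rw [mul_comm] at hfg
      exact Or.inl (isUnit_of_curvePolynomial_eq_mul hn hy₀ hfg fun z hz => by
        simpa [MvPolynomial.zeroLocus_span] using h hz)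

/-! ### The differential equation -/

/-- The numerator of the logarithmic derivative of `H` along a curve of slope `d`: it vanishes
exactly when `d = c x y³ + y²`. -/
lemma slope_identity (hn : 1 ≤ n) (x y d : ℂ) :
    d * (1 - x * y / v₁ n) * (1 - x * y / v₂ n) +
        n * y * (1 - x * y / v₂ n) * (-((y + x * d) / v₁ n)) -
        (n + 1) * y * (1 - x * y / v₁ n) * (-((y + x * d) / v₂ n)) =
      d - (c n * x * y ^ 3 + y ^ 2) := by
  have h1 := two_mul_add_one_ne_zero n
  rw [div_v₁ hn, div_v₂, div_v₁ hn, div_v₂, c_eq]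
  obtain ⟨N, hN⟩ : ∃ N, 2 * (n : ℂ) + 1 = N := ⟨_, rfl⟩
  rw [hN] at h1 ⊢
  field_simp
  rw [← hN]
  ring

lemma hasDerivAt_one_sub_mul_div {φ : ℂ → ℂ} {d x : ℂ} (h : HasDerivAt φ d x) (v : ℂ) :
    HasDerivAt (fun x => 1 - x * φ x / v) (-((φ x + x * d) / v)) x := by
  have := (((hasDerivAt_id x).mul h).div_const v).const_sub 1
  simpa using this

/-- Every branch of the curve solves the differential equation. -/
lemma IsBranch.hasDerivAt (hn : 1 ≤ n) (hy₀ : y₀ ≠ 0) {p : ℂ} {g : ℂ → ℂ}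
    (hg : IsBranch n y₀ p g) :
    ∀ᶠ x in 𝓝 p, HasDerivAt g (c n * x * g x ^ 3 + g x ^ 2) x := by
  filter_upwards [hg.1.eventually_analyticAt, hg.2.eventually_nhds] with x hx hmem
  have hd := hx.differentiableAt.hasDerivAt
  obtain ⟨hq, hrel⟩ := mem_solutionCurve.1 hmem.self_of_nhds
  have hp : 1 - x * g x / v₁ n ≠ 0 :=
    (div_ne_zero_iff.1 (parameter_ne_zero hn hy₀ hmem.self_of_nhds)).1
  have hL := hd.mul ((hasDerivAt_one_sub_mul_div hd (v₁ n)).pow n)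
  have hR := ((hasDerivAt_one_sub_mul_div hd (v₂ n)).pow (n + 1)).const_mul y₀
  have heq := hL.unique (hR.congr_of_eventuallyEq (by
    filter_upwards [hmem] with z hz using (mem_solutionCurve.1 hz).2))
  simp only [Pi.pow_apply] at heq
  have key := slope_identity hn x (g x) (deriv g x)
  refine hd.congr_deriv ?_
  rw [← sub_eq_zero, ← key]
  generalize deriv g x = d at *
  generalize -((g x + x * d) / v₁ n) = p' at *
  generalize -((g x + x * d) / v₂ n) = q' at *
  generalize 1 - x * g x / v₁ n = p at *
  generalize 1 - x * g x / v₂ n = q at *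
  obtain ⟨k, rfl⟩ : ∃ k, n = k + 1 := ⟨n - 1, by omega⟩
  simp only [Nat.add_sub_cancel] at heq
  -- The derivative of the equation of the curve is `p ^ k / q` times the numerator in
  -- `slope_identity`, by the equation itself.
  refine (mul_eq_zero.1 (?_ : p ^ k * _ = 0)).resolve_left (pow_ne_zero _ hp)
  push_cast at heq ⊢
  linear_combination q * heq - (k + 2) * q' * hrel

lemma exists_isLocalSolution (hn : 1 ≤ n) (hy₀ : y₀ ≠ 0) :
    ∃ φ : ℂ → ℂ, IsLocalSolution n y₀ φ := by
  have h1 : (1 : ℂ) ≠ node n := by exact_mod_cast (node_lt_one n).ne'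
  obtain ⟨h, -⟩ := isBranch_branchAt (p := 0) hn hy₀ one_ne_zero h1 (by simp [cover_one])
  refine ⟨_, h.1, ?_, h.hasDerivAt hn hy₀⟩
  have := (mem_solutionCurve.1 h.2.self_of_nhds).2
  simpa using this

/-- `H` is a first integral: every solution stays on the curve. -/
lemma IsLocalSolution.isBranch (hn : 1 ≤ n) {φ : ℂ → ℂ} (hφ : IsLocalSolution n y₀ φ) :
    IsBranch n y₀ 0 φ := by
  obtain ⟨ha, h0, hode⟩ := hφ
  have hc : ContinuousAt (fun x => 1 - x * φ x / v₂ n) 0 := by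
    have := ha.continuousAt
    fun_prop
  obtain ⟨ρ, hρ, hball⟩ := Metric.eventually_nhds_iff_ball.1
    (hode.and (hc.eventually_ne (show 1 - 0 * φ 0 / v₂ n ≠ 0 by simp)))
  refine ⟨ha, ?_⟩
  have hd : ∀ x ∈ Metric.ball (0 : ℂ) ρ, HasDerivAt (fun x => H n x (φ x)) 0 x := by
    intro x hx
    obtain ⟨hx1, hx2⟩ := hball x hx
    have key := slope_identity hn x (φ x) (c n * x * φ x ^ 3 + φ x ^ 2)
    rw [sub_self] at key
    have h := (hx1.mul ((hasDerivAt_one_sub_mul_div hx1 (v₁ n)).pow n)).div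
      ((hasDerivAt_one_sub_mul_div hx1 (v₂ n)).pow (n + 1)) (pow_ne_zero _ hx2)
    refine h.congr_deriv ?_
    rw [div_eq_zero_iff]
    left
    obtain ⟨k, rfl⟩ : ∃ k, n = k + 1 := ⟨n - 1, by omega⟩
    simp only [Nat.add_sub_cancel, Pi.mul_apply, Pi.pow_apply]
    push_cast at key ⊢
    linear_combination (1 - x * φ x / v₁ (k + 1)) ^ k * (1 - x * φ x / v₂ (k + 1)) ^ (k + 1) * key
  filter_upwards [Metric.ball_mem_nhds (0 : ℂ) hρ] with x hx
  have hconst := Metric.isOpen_ball.is_const_of_deriv_eq_zero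
    (convex_ball (0 : ℂ) ρ).isPreconnected
    (fun z hz => (hd z hz).differentiableAt.differentiableWithinAt)
    (fun z hz => (hd z hz).deriv) hx (Metric.mem_ball_self hρ)
  refine ⟨(hball x hx).2, ?_⟩
  simp only [Matrix.cons_val_zero, Matrix.cons_val_one]
  rw [hconst, h0]
  simp [H]

lemma parameter_zero (n : ℕ) (y : ℂ) : parameter n 0 y = 1 := by simp [parameter]

/-! ### Lifts of the paths -/

/-- The continuation of the solution `φ` along the segment from `0` follows `outer`. -/
lemma exists_lift_segment_zero (hn : 1 ≤ n) (hy₀ : y₀ ≠ 0) {s : ℝ} (hs0 : 0 ≤ s) (hs1 : s < 1)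
    {q : ℂ} (hq : q = s * movableSingularity n y₀) :
    ∃ ℓ : Path 1 (outer n s), IsLift n y₀ (Path.segment 0 q) ℓ := by
  have hx₀ := movableSingularity_ne_zero hn hy₀
  have hlt : ∀ t : unitInterval, ‖(((t : ℝ) * s : ℝ) : ℂ)‖ < 1 := by
    intro t
    rw [Complex.norm_of_nonneg (mul_nonneg t.2.1 hs0)]
    exact (mul_le_of_le_one_left hs0 t.2.2).trans_lt hs1
  have hc : Continuous fun t : unitInterval => outer n (((t : ℝ) * s : ℝ) : ℂ) :=
    (continuousOn_outer hn).comp_continuous (by fun_prop) fun t => mem_ball_zero_iff.2 (hlt t)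
  refine ⟨⟨⟨_, hc⟩, by simp [outer_zero hn], by simp⟩, fun t => ⟨?_, ?_, ?_⟩⟩
  · rw [Path.coe_mk_mk, cover_outer hn (hlt t), Path.segment_apply, hq, eq_div_iff hx₀]
    simp [AffineMap.lineMap_apply, mul_assoc]
  · exact outer_ne_zero hn (hlt t)
  · exact outer_ne_node hn (hlt t)

/-- Away from `0`, the segment lifts to the real parameters to the left of `node n`. -/
lemma exists_lift_segment (hn : 1 ≤ n) (hy₀ : y₀ ≠ 0) {s s' : ℝ} (hs : s ∈ Set.Ioo (0 : ℝ) 1)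
    (hs' : s' ∈ Set.Ioo (0 : ℝ) 1) {q q' : ℂ} (hq : q = s * movableSingularity n y₀)
    (hq' : q' = s' * movableSingularity n y₀) :
    ∃ ℓ : Path (inner n (realRoot n s)) (inner n (realRoot n s')),
      IsLift n y₀ (Path.segment q q') ℓ := by
  have hx₀ := movableSingularity_ne_zero hn hy₀
  have hmem : ∀ t : unitInterval, s + (t : ℝ) * (s' - s) ∈ Set.Ioo (0 : ℝ) 1 := fun t =>
    (convex_Ioo (0 : ℝ) 1).add_smul_sub_mem hs hs' t.2
  have hlt := fun t => norm_realRoot_lt hn (hmem t).1.le (hmem t).2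
  have hc : Continuous fun t : unitInterval => inner n (realRoot n (s + (t : ℝ) * (s' - s))) :=
    (continuousOn_inner hn).comp_continuous ((continuous_realRoot n).comp (by fun_prop))
      fun t => mem_ball_zero_iff.2 (hlt t)
  refine ⟨⟨⟨_, hc⟩, by simp, by simp⟩, fun t => ⟨?_, ?_, ?_⟩⟩
  · rw [Path.coe_mk_mk, cover_inner hn (hlt t), realRoot_pow hn (hmem t).1.le, Path.segment_apply,
      hq, hq', eq_div_iff hx₀]
    simp [AffineMap.lineMap_apply]
    ring
  · exact inner_ne_zero hn (hlt t) (realRoot_ne_zero (hmem t).1)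
  · exact inner_ne_node hn (hlt t)

lemma exists_lift_turn (hn : 1 ≤ n) (hy₀ : y₀ ≠ 0) {r : ℝ} (hr0 : 0 < r) (hr1 : r < 1) :
    ∃ ℓ : Path (outer n ((1 - r : ℝ) : ℂ)) (inner n (realRoot n (1 - r))),
      IsLift n y₀ (turn (movableSingularity n y₀) ((1 - (r : ℂ)) * movableSingularity n y₀)) ℓ := by
  have hx₀ := movableSingularity_ne_zero hn hy₀
  obtain ⟨ℓ, hℓ⟩ := exists_loop hn hr0 hr1
  refine ⟨ℓ, fun t => ⟨?_, ?_, ?_⟩⟩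
  · rw [hℓ, turn, Path.coe_mk_mk, eq_div_iff hx₀]
    ring
  · intro h
    have h2 := one_sub_mul_exp_mem hr0 hr1 t
    rw [← hℓ, h, cover_zero hn] at h2
    simp at h2
  · intro h
    have h2 := one_sub_mul_exp_mem hr0 hr1 t
    rw [← hℓ, h, cover_node hn] at h2
    simp at h2

/-- A turn around `0` in the plane of `uⁿ` is an `n`-th of a turn in the plane of `u`. -/
lemma exists_lift_turn_zero (hn : 1 ≤ n) (hy₀ : y₀ ≠ 0) {u p : ℂ} (hu0 : u ≠ 0) (hu : ‖u‖ < 1)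
    (hp : p = u ^ n * movableSingularity n y₀) :
    ∃ ℓ : Path (inner n u) (inner n (u * Complex.exp (2 * Real.pi * Complex.I / n))),
      IsLift n y₀ (turn 0 p) ℓ := by
  have hx₀ := movableSingularity_ne_zero hn hy₀
  have hn0 := cast_ne_zero hn
  have hlt : ∀ t : ℝ, ‖u * Complex.exp (2 * Real.pi * Complex.I / n * (t : ℂ))‖ < 1 := by
    intro t
    rw [norm_mul, show 2 * (Real.pi : ℂ) * Complex.I / n * (t : ℂ) =
      ((2 * Real.pi / n * t : ℝ) : ℂ) * Complex.I by push_cast; ring,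
      Complex.norm_exp_ofReal_mul_I, mul_one]
    exact hu
  have hc : Continuous fun t : unitInterval =>
      inner n (u * Complex.exp (2 * Real.pi * Complex.I / n * ((t : ℝ) : ℂ))) :=
    (continuousOn_inner hn).comp_continuous (by fun_prop) fun t => mem_ball_zero_iff.2 (hlt t)
  refine ⟨⟨⟨_, hc⟩, by simp, by simp⟩, fun t => ⟨?_, ?_, ?_⟩⟩
  · rw [Path.coe_mk_mk, cover_inner hn (hlt t), turn, Path.coe_mk_mk, mul_pow,
      ← Complex.exp_nat_mul, hp, eq_div_iff hx₀, sub_zero, zero_add,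
      show (n : ℂ) * (2 * Real.pi * Complex.I / n * ((t : ℝ) : ℂ)) =
        2 * Real.pi * Complex.I * ((t : ℝ) : ℂ) by field_simp]
    ring
  · exact inner_ne_zero hn (hlt t) (mul_ne_zero hu0 (Complex.exp_ne_zero _))
  · exact inner_ne_node hn (hlt t)

lemma exists_lift_turns (hn : 1 ≤ n) (hy₀ : y₀ ≠ 0) {u p : ℂ} (hu0 : u ≠ 0) (hu : ‖u‖ < 1)
    (hp : p = u ^ n * movableSingularity n y₀) (m : ℕ) :
    ∃ ℓ : Path (inner n u) (inner n (u * Complex.exp (2 * Real.pi * Complex.I / n) ^ m)),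
      IsLift n y₀ (turns 0 p m) ℓ := by
  have hx₀ := movableSingularity_ne_zero hn hy₀
  have hζ := Complex.isPrimitiveRoot_exp n (by omega)
  induction m with
  | zero =>
    rw [pow_zero, mul_one]
    refine ⟨Path.refl _, fun t => ⟨?_, inner_ne_zero hn hu hu0, inner_ne_node hn hu⟩⟩
    rw [Path.refl_apply, turns, Path.refl_apply, cover_inner hn hu, hp, mul_div_cancel_right₀ _ hx₀]
  | succ m ih =>
    obtain ⟨ℓ, hℓ⟩ := ih
    obtain ⟨ℓ', hℓ'⟩ := exists_lift_turn_zero hn hy₀ (p := p)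
      (mul_ne_zero hu0 (pow_ne_zero m (Complex.exp_ne_zero _)))
      (mem_ball_zero_iff.1 (norm_mul_pow_lt hu n m))
      (by rw [hp, mul_pow, ← pow_mul, mul_comm m, pow_mul, hζ.pow_eq_one, one_pow, mul_one])
    rw [pow_succ _ m, ← mul_assoc u]
    exact ⟨ℓ.trans ℓ', hℓ.trans hℓ'⟩

lemma exists_lift_omegaThenTurns (hn : 1 ≤ n) (hy₀ : y₀ ≠ 0) {r ε : ℝ} (hr0 : 0 < r) (hr1 : r < 1)
    (hε0 : 0 < ε) (hε1 : ε < 1) {p : ℂ} (hp : p = ε * movableSingularity n y₀) (m : ℕ) :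
    ∃ ℓ : Path 1 (inner n (realRoot n ε * Complex.exp (2 * Real.pi * Complex.I / n) ^ m)),
      IsLift n y₀ (omegaThenTurns (movableSingularity n y₀) r p m) ℓ := by
  have h : 1 - r ∈ Set.Ioo (0 : ℝ) 1 := ⟨by linarith, by linarith⟩
  have hq : (1 - (r : ℂ)) * movableSingularity n y₀ =
      ((1 - r : ℝ) : ℂ) * movableSingularity n y₀ := by push_cast; rfl
  obtain ⟨ℓ₁, h₁⟩ := exists_lift_segment_zero hn hy₀ h.1.le h.2 hq
  obtain ⟨ℓ₂, h₂⟩ := exists_lift_turn hn hy₀ hr0 hr1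
  obtain ⟨ℓ₃, h₃⟩ := exists_lift_segment hn hy₀ h ⟨hε0, hε1⟩ hq hp
  obtain ⟨ℓ₄, h₄⟩ := exists_lift_turns hn hy₀ (realRoot_ne_zero hε0)
    (norm_realRoot_lt hn hε0.le hε1) (p := p) (by rw [realRoot_pow hn hε0.le, hp]) m
  exact ⟨((ℓ₁.trans ℓ₂).trans ℓ₃).trans ℓ₄, ((h₁.trans h₂).trans h₃).trans h₄⟩

/-! ### The remaining branches -/

/-- The continuation of `φ` along the segment is the branch with parameter `outer n ε`. -/
lemma isRemainingBranch_iff (hn : 1 ≤ n) (hy₀ : y₀ ≠ 0) {φ : ℂ → ℂ} (hφ : IsBranch n y₀ 0 φ)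
    {ε : ℝ} (hε0 : 0 ≤ ε) (hε1 : ε < 1) {p : ℂ} (hp : p = ε * movableSingularity n y₀)
    {g : ℂ → ℂ} : IsRemainingBranch n y₀ φ p g ↔
      IsBranch n y₀ p g ∧ parameter n p (g p) ≠ outer n ε := by
  have hx₀ := movableSingularity_ne_zero hn hy₀
  have hlt : ‖(ε : ℂ)‖ < 1 := by rwa [Complex.norm_of_nonneg hε0]
  obtain ⟨ℓ, hℓ⟩ := exists_lift_segment_zero hn hy₀ hε0 hε1 hp
  refine and_congr_right fun hg => not_congr ⟨fun h => ?_, fun h => ?_⟩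
  · obtain ⟨h1, h2⟩ := isBranch_branchAt hn hy₀ (p := p) (outer_ne_zero hn hlt)
      (outer_ne_node hn hlt) (by rw [cover_outer hn hlt, hp, mul_div_cancel_right₀ _ hx₀])
    have := h.unique (hℓ.continuesTo hn hy₀ hφ (parameter_zero n _) h1 h2)
    rw [this.eq_of_nhds, h2]
  · exact hℓ.continuesTo hn hy₀ hφ (parameter_zero n _) hg h

end AbelModel

theorem theorem6p1 (n : ℕ) (hn : 1 ≤ n) (y₀ : ℂ) (hy₀ : y₀ ≠ 0) :
    (AbelModel.IsIrreducibleAlgebraicSet (AbelModel.solutionCurve n y₀) ∧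
      Irreducible (AbelModel.curvePolynomial n y₀) ∧
      AbelModel.solutionCurve n y₀ =
        MvPolynomial.zeroLocus ℂ (Ideal.span {AbelModel.curvePolynomial n y₀})) ∧
    (∃ φ : ℂ → ℂ, AbelModel.IsLocalSolution n y₀ φ) ∧
    ∀ φ : ℂ → ℂ, AbelModel.IsLocalSolution n y₀ φ →
      AbelModel.IsBranch n y₀ 0 φ ∧
      ∀ r ε : ℝ, 0 < r → r < 1 → 0 < ε → ε < 1 →
        ∀ x₀ p : ℂ, x₀ = AbelModel.movableSingularity n y₀ → p = (ε : ℂ) * x₀ →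
          (∃ g : ℂ → ℂ, AbelModel.IsBranch n y₀ p g ∧
            AbelModel.ContinuesTo (Path.segment 0 p) φ g) ∧
          (AbelModel.remainingBranches n y₀ φ p).ncard = n ∧
          (∀ m : ℕ, ∃ g : ℂ → ℂ, AbelModel.IsRemainingBranch n y₀ φ p g ∧
            AbelModel.ContinuesTo (AbelModel.omegaThenTurns x₀ r p m) φ g) ∧
          (∀ g : ℂ → ℂ, AbelModel.IsRemainingBranch n y₀ φ p g →
            ∃ m : ℕ, m < n ∧
              AbelModel.ContinuesTo (AbelModel.omegaThenTurns x₀ r p m) φ g) := by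
  open AbelModel in
  refine ⟨⟨isIrreducible_solutionCurve hn hy₀, irreducible_curvePolynomial hn hy₀,
    solutionCurve_eq_zeroLocus hn⟩, exists_isLocalSolution hn hy₀, fun φ hφ => ?_⟩
  have hb := hφ.isBranch hn
  refine ⟨hb, fun r ε hr0 hr1 hε0 hε1 x₀ p hx₀ hp => ?_⟩
  subst hx₀
  have hx₀ := movableSingularity_ne_zero hn hy₀
  have hζ := Complex.isPrimitiveRoot_exp n (by omega)
  have hu0 := realRoot_ne_zero (n := n) hε0
  have hu1 := norm_realRoot_lt hn hε0.le hε1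
  have hun := realRoot_pow hn hε0.le
  have hlt : ‖(ε : ℂ)‖ < 1 := by rwa [Complex.norm_of_nonneg hε0.le]
  have hpε : p / movableSingularity n y₀ = ε := by rw [hp, mul_div_cancel_right₀ _ hx₀]
  have hk := fun k => mem_ball_zero_iff.1 (norm_mul_pow_lt hu1 n k)
  have hrem := fun g => isRemainingBranch_iff hn hy₀ hb hε0.le hε1 hp (g := g)
  have hlift := exists_lift_omegaThenTurns hn hy₀ hr0 hr1 hε0 hε1 hp
  have hfib := fun a => eq_outer_or_eq_inner hn hu1 hu0 (a := a)
  rw [hun] at hfib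
  generalize realRoot n ε = u at *
  generalize Complex.exp (2 * Real.pi * Complex.I / n) = ζ at *
  have hζ0 : ζ ≠ 0 := hζ.ne_zero (by omega)
  have hbr : ∀ k, IsBranch n y₀ p (branchAt n y₀ (inner n (u * ζ ^ k))) ∧
      parameter n p (branchAt n y₀ (inner n (u * ζ ^ k)) p) = inner n (u * ζ ^ k) := fun k =>
    isBranch_branchAt hn hy₀ (inner_ne_zero hn (hk k) (mul_ne_zero hu0 (pow_ne_zero _ hζ0)))
      (inner_ne_node hn (hk k)) (by
        rw [cover_inner hn (hk k), mul_pow, ← pow_mul, mul_comm k, pow_mul, hζ.pow_eq_one, one_pow,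
          mul_one, hun, hpε])
  have hbrem : ∀ k, IsRemainingBranch n y₀ φ p (branchAt n y₀ (inner n (u * ζ ^ k))) := fun k =>
    (hrem _).2 ⟨(hbr k).1, by rw [(hbr k).2]; exact inner_ne_outer hn (hk k) hlt⟩
  -- The parameter of a remaining branch is one of the `n` points of the fibre near `0`.
  have hpar : ∀ g, IsRemainingBranch n y₀ φ p g →
      ∃ k < n, parameter n p (g p) = inner n (u * ζ ^ k) := by
    intro g hg
    obtain ⟨h1, h2⟩ := (hrem g).1 hg
    exact (hfib _ (by rw [cover_parameter hn hy₀ h1.2.self_of_nhds, hpε])).resolve_left h2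
  refine ⟨?_, ?_, fun m => ?_, fun g hg => ?_⟩
  · obtain ⟨h1, h2⟩ := isBranch_branchAt hn hy₀ (p := p) (outer_ne_zero hn hlt)
      (outer_ne_node hn hlt) (by rw [cover_outer hn hlt, hpε])
    obtain ⟨ℓ, hℓ⟩ := exists_lift_segment_zero hn hy₀ hε0.le hε1 hp
    exact ⟨_, h1, hℓ.continuesTo hn hy₀ hb (parameter_zero n _) h1 h2⟩
  · have himage : remainingBranches n y₀ φ p =
        (fun k => ((branchAt n y₀ (inner n (u * ζ ^ k)) : ℂ → ℂ) : Germ (𝓝 p) ℂ)) ''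
          (Finset.range n : Set ℕ) := by
      ext G
      constructor
      · rintro ⟨g, hg, rfl⟩
        obtain ⟨k, hkn, hgk⟩ := hpar g hg
        exact ⟨k, by simpa using hkn,
          (Germ.coe_eq.2 (((hrem g).1 hg).1.eventuallyEq_branchAt hn hy₀ hgk)).symm⟩
      · rintro ⟨k, -, rfl⟩
        exact ⟨_, hbrem k, rfl⟩
    rw [himage, Set.InjOn.ncard_image, Set.ncard_coe_finset, Finset.card_range]
    intro i hi j hj hij
    have hval := (Germ.coe_eq.1 hij).eq_of_nhds
    have h1 : inner n (u * ζ ^ i) = inner n (u * ζ ^ j) := by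
      rw [← (hbr i).2, ← (hbr j).2, hval]
    exact hζ.pow_inj (by simpa using hi) (by simpa using hj)
      (mul_left_cancel₀ hu0 (inner_inj hn (hk i) (hk j) h1))
  · obtain ⟨ℓ, hℓ⟩ := hlift m
    exact ⟨_, hbrem m, hℓ.continuesTo hn hy₀ hb (parameter_zero n _) (hbr m).1 (hbr m).2⟩
  · obtain ⟨m, hm, hgm⟩ := hpar g hg
    obtain ⟨ℓ, hℓ⟩ := hlift m
    exact ⟨m, hm, hℓ.continuesTo hn hy₀ hb (parameter_zero n _) ((hrem g).1 hg).1 hgm⟩
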